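/- Let $d\in\{1,2\}$ and let $p_0\ge 1$ be an integer. For each $1\le p\le p_0$ let $V^{(p)}\in W^{p,\infty}(\mathbb{R}^{pd})$ be a real, non-negative potential. For $\beta>0$ and $N\ge 1$ consider on $L^2(\mathbb{R}^{dN})$, with variables $x_1,\dots,x_N\in\mathbb{R}^d$, the self-adjoint operator $$H_N=\sum_{i=1}^N(-\Delta_{x_i})+\sum_{p=1}^{p_0}\frac1{N^p}\sum_{1\le i_1<\cdots<i_{p+1}\le N}N^{pd\beta}\,V^{(p)}\big(N^\beta(x_{i_1}-x_{i_2}),\dots,N^\beta(x_{i_1}-x_{i_{p+1}})\big),$$ and let $L^2_s(\mathbb{R}^{dN})$ be the subspace of functions that are invariant under all permutations of $x_1,\dots,x_N$. Then there is a constant $C>0$, depending only on $p_0$, $d$ and the potentials $V^{(p)}$, such that for every $\beta$ with $0<\beta<\frac1{2dp_0+2}$ and every integer $k\ge 0$ there is $N_0(k)\ge k$ such that $$\langle\psi,(H_N+N)^k\psi\rangle\;\ge\;C^kN^k\,\langle\psi,(1-\Delta_{x_1})\cdots(1-\Delta_{x_k})\psi\rangle$$ for all $N\ge N_0(k)$ and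 all $\psi\in L^2_s(\mathbb{R}^{dN})$. Both sides are understood as quadratic forms with values in $[0,\infty]$, that is, for a non-negative self-adjoint operator $A$, $\langle\psi,A\psi\rangle=\|A^{1/2}\psi\|^2$, with the value $\infty$ when $\psi$ is not in the domain of $A^{1/2}$; in particular the right side is finite whenever the left side is. -/

import Mathlib

open MeasureTheory FourierTransform
open scoped ENNReal ContDiff

namespace ManyBody

noncomputable section

/-- The configuration space `ℝ^{dN}` of `N` particles in `ℝ^d`, with its Euclidean structure.
The coordinate `(i, a)` is the `a`-th coordinate of the `i`-th particle. The potential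
`V^{(p)}` lives on `Config d p = ℝ^{pd}`. -/
abbrev Config (d N : ℕ) : Type := EuclideanSpace ℝ (Fin N × Fin d)

/-- The Hilbert space `L²(ℝ^{dN})`. -/
abbrev WaveFn (d N : ℕ) : Type := Lp ℂ 2 (volume : Measure (Config d N))

/-- The `i`-th block `x_i ∈ ℝ^d` of `x = (x_1, …, x_N)`. -/
def particle {d N : ℕ} (x : Config d N) (i : Fin N) : EuclideanSpace ℝ (Fin d) :=
  WithLp.toLp 2 fun a => x (i, a)

/-- `(x_{σ(1)}, …, x_{σ(N)})`. -/
def permute {d N : ℕ} (σ : Equiv.Perm (Fin N)) (x : Config d N) : Config d N :=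
  WithLp.toLp 2 fun ia => x (σ ia.1, ia.2)

/-- `ψ ∈ L²_s(ℝ^{dN})`: the bosonic wave functions. -/
def IsSymmetric {d N : ℕ} (ψ : WaveFn d N) : Prop :=
  ∀ σ : Equiv.Perm (Fin N), ∀ᵐ x : Config d N, ψ (permute σ x) = ψ x

/-- The Sobolev space `W^{m,∞}(E)` of real functions: `f` is essentially bounded, and each
weak derivative of `f` of order `n ≤ m` (in arbitrary directions `v 0, …, v (n-1)`) is an
essentially bounded function `g`. -/
def MemSobolevInfty {E : Type*} [NormedAddCommGroup E] [NormedSpace ℝ E] [MeasureSpace E]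
    (m : ℕ) (f : E → ℝ) : Prop :=
  MemLp f ∞ volume ∧
    ∀ n ≤ m, ∀ v : Fin n → E, ∃ g : E → ℝ, MemLp g ∞ volume ∧
      ∀ φ : E → ℝ, ContDiff ℝ ∞ φ → HasCompactSupport φ →
        ∫ x, f x * iteratedFDeriv ℝ n φ x v = (-1) ^ n * ∫ x, g x * φ x

/-- `(x_{i_1} - x_{i_2}, …, x_{i_1} - x_{i_{p+1}}) ∈ ℝ^{pd}`. -/
def differences {d N p : ℕ} (i : Fin (p + 1) → Fin N) (x : Config d N) : Config d p :=
  WithLp.toLp 2 fun ja => x (i 0, ja.2) - x (i ja.1.succ, ja.2)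

/-- The rescaled potential `V_N(y) = N^{pdβ} V(N^β y)`. -/
def scaledPotential {d p : ℕ} (N : ℕ) (β : ℝ) (V : Config d p → ℝ) (y : Config d p) : ℝ :=
  (N : ℝ) ^ ((p : ℝ) * (d : ℝ) * β) * V ((N : ℝ) ^ β • y)

open Classical in
/-- The total interaction potential
`∑_{p=1}^{p₀} N^{-p} ∑_{i_1 < ⋯ < i_{p+1}} V_N^{(p)}(x_{i_1} - x_{i_2}, …, x_{i_1} - x_{i_{p+1}})`.
-/
def interaction (d N p₀ : ℕ) (β : ℝ) (V : (p : ℕ) → Config d p → ℝ) (x : Config d N) : ℝ :=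
  ∑ p ∈ Finset.Icc 1 p₀, ((N : ℝ) ^ p)⁻¹ *
    ∑ i : Fin (p + 1) → Fin N with StrictMono i, scaledPotential N β (V p) (differences i x)

/-- The Fourier symbol `(2π|ξ_i|)²` of `-Δ_{x_i}` (Mathlib's Fourier transform has the kernel
`e^{-2πi x·ξ}`). -/
def laplaceSymbol {d N : ℕ} (ξ : Config d N) (i : Fin N) : ℝ :=
  (2 * Real.pi * ‖particle ξ i‖) ^ 2

/-- The graph of the operator `-∑_i Δ_{x_i} + U` on `L²(ℝ^{dN})`: `HamiltonianRel U ψ φ` says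
that `U ψ ∈ L²`, that `ψ` lies in the domain and that `-∑_i Δ_{x_i} ψ + U ψ = φ ∈ L²`, the
Laplacians being taken in the sense of Fourier multipliers. For bounded real `U` this is the
self-adjoint operator with domain `H²(ℝ^{dN})`. -/
def HamiltonianRel {d N : ℕ} (U : Config d N → ℝ) (ψ φ : WaveFn d N) : Prop :=
  ∃ w : WaveFn d N, (∀ᵐ x : Config d N, w x = (U x : ℂ) * ψ x) ∧
    ∀ᵐ ξ : Config d N, 𝓕 φ ξ = ((∑ i, laplaceSymbol ξ i : ℝ) : ℂ) * 𝓕 ψ ξ + 𝓕 w ξ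

/-- The graph of `(H + N)^m` for `H = -∑_i Δ_{x_i} + U`, on its natural domain:
`ShiftedPowRel U m ψ φ` says that `ψ ∈ D((H + N)^m)` and `(H + N)^m ψ = φ`. -/
def ShiftedPowRel {d N : ℕ} (U : Config d N → ℝ) : ℕ → WaveFn d N → WaveFn d N → Prop
  | 0, ψ, φ => φ = ψ
  | m + 1, ψ, φ => ∃ χ η : WaveFn d N,
      ShiftedPowRel U m ψ χ ∧ HamiltonianRel U χ η ∧ φ = η + (N : ℂ) • χ

/-- The quadratic form `⟨χ, (H + N) χ⟩ ∈ [0, ∞]` of `H + N`, `H = -∑_i Δ_{x_i} + U`, `U ≥ 0`: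
kinetic energy plus potential energy plus `N ‖χ‖²`. It is `∞` off the form domain. -/
def shiftedForm {d N : ℕ} (U : Config d N → ℝ) (χ : WaveFn d N) : ℝ≥0∞ :=
  (∫⁻ ξ, ENNReal.ofReal (∑ i, laplaceSymbol ξ i) * ‖𝓕 χ ξ‖ₑ ^ 2)
    + (∫⁻ x, ENNReal.ofReal (U x) * ‖χ x‖ₑ ^ 2)
    + (N : ℝ≥0∞) * ‖χ‖ₑ ^ 2

/-- The quadratic form `⟨ψ, (H + N)^k ψ⟩ ∈ [0, ∞]` of the non-negative self-adjoint operator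
`(H + N)^k`, that is `‖(H + N)^{k/2} ψ‖²`, with the value `∞` off the form domain
`D((H + N)^{k/2})`. For `k = 2m` it is `‖(H + N)^m ψ‖²`; for `k = 2m + 1` it is the form of
`H + N` at `(H + N)^m ψ`. There is at most one `φ` as below; the infimum over the empty family
is `∞`. -/
def powForm {d N : ℕ} (U : Config d N → ℝ) (k : ℕ) (ψ : WaveFn d N) : ℝ≥0∞ :=
  ⨅ (φ : WaveFn d N) (_ : ShiftedPowRel U (k / 2) ψ φ),
    if Even k then ‖φ‖ₑ ^ 2 else shiftedForm U φ

/-- The quadratic form `⟨ψ, (1 - Δ_{x_1}) ⋯ (1 - Δ_{x_k}) ψ⟩ ∈ [0, ∞]`, for `k ≤ N`. -/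
def sobolevForm {d N : ℕ} (k : ℕ) (ψ : WaveFn d N) : ℝ≥0∞ :=
  ∫⁻ ξ, ENNReal.ofReal (∏ i : Fin N with i.val < k, (1 + laplaceSymbol ξ i)) * ‖𝓕 ψ ξ‖ₑ ^ 2

end

end ManyBody

/-!
The estimate is proved without using the symmetry of `ψ`, in the form
`k! ∑_{|A| = k} ⟨ψ, ∏_{i ∈ A} (1 - Δ_{x_i}) ψ⟩ ≤ 2^k ⟨ψ, (H + N)^k ψ⟩` for large `N`
(`factorial_mul_sobolevSum_le`). This matters because the potentials `V^{(p)}` are not assumed to be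
symmetric in their arguments, so that `H` need not map symmetric functions to symmetric ones. For
symmetric `ψ` all the sets `A` contribute equally, and `k! (N choose k) ≥ (N/2)^k`.

The induction goes from `k` to `k + 2`. Write `s_i` for `1 - Δ_{x_i}`, `S_A` for `∏_{i ∈ A} s_i` and
`K_A` for `∑_{j ∉ A} s_j`. With `φ = (H + N) ψ = ∑_i s_i ψ + W ψ`, where `W` is the interaction,
testing `φ` against `S_A K_A ψ` gives
`⟨ψ, S_A K_A² ψ⟩ + Re ⟨S_A K_A ψ, W ψ⟩ ≤ ¼ ⟨ψ, S_A K_A² ψ⟩ + ⟨φ, S_A φ⟩`, and the sum of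
`⟨ψ, S_A K_A² ψ⟩` over `|A| = k` dominates `(k + 1)(k + 2)` times the form of order `k + 2`.

It remains to see that the interaction is a small perturbation. The expression `S_A K_A` is the sum
of `S_J` over `J = A ∪ {j}`. A potential which does not involve the particles in `J` commutes with
`S_J` and contributes a non-negative term (`multForm_mul_nonneg`). If the potential involves
`q ≥ 1` particles of `J`, one of them, `a`, is singled out, and
`|⟨S_J ψ, V ψ⟩| ≤ ‖S_{J∖a}^{1/2} s_a ψ‖ ‖S_{J∖a}^{1/2} V ψ‖`; here only `q - 1 ≤ p` derivatives fall
on `V`, each costing a factor `N^β` (`abs_multForm_mul_insert_le`, `hasDiffBound_scaledPotential`).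
Since there are of order `N^{p+1-q}` such potentials, they are of total size `N^{pdβ}`
(`neg_le_sum_multForm`), and the bounds `∑_{j ∉ A} s_j² ≤ K_A²` and `N - k ≤ K_A` gain `N^{-1/2}`
(`sum_errorForm_le`). The condition on `β` gives `p₀ d β < 1/2`, so that the gain wins.

To make this rigorous for all `ψ` in the operator domain, the Laplacians in `s_i` are replaced by
discrete ones, of step `h`. All forms are then finite, the discrete derivatives in a particle still
commute with potentials not involving it, and their product rule needs no regularity of `ψ`. The
estimates are uniform in `h`, and Fatou's lemma removes the discretization
(`mul_sobolevSum_le_of_discrete`). The weak derivatives of `V^{(p)}` enter only through the bound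
`ae_abs_iterDiffQuot_le` on iterated difference quotients.
-/

namespace ManyBody

noncomputable section

/-! ### Difference quotients of functions with bounded weak derivatives -/

section DifferenceQuotients

variable {E : Type*} [NormedAddCommGroup E] [NormedSpace ℝ E]

/-- The difference quotient `(f(x + hv) - f(x)) / h`. -/
def diffQuot (h : ℝ) (v : E) (f : E → ℝ) (x : E) : ℝ := (f (x + h • v) - f x) / h

/-- The iterated difference quotient of `f` along the directions in a list. -/
def iterDiffQuot (h : ℝ) : List E → (E → ℝ) → E → ℝ
  | [], f => f
  | v :: l, f => iterDiffQuot h l (diffQuot h v f)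

/-- The iterated directional derivative of `f` along the directions in a list. -/
def iterDirDeriv : List E → (E → ℝ) → E → ℝ
  | [], f => f
  | v :: l, f => fun x => fderiv ℝ (iterDirDeriv l f) x v

lemma contDiff_iterDirDeriv {f : E → ℝ} (hf : ContDiff ℝ ∞ f) :
    ∀ l : List E, ContDiff ℝ ∞ (iterDirDeriv l f)
  | [] => hf
  | v :: l => (((contDiff_iterDirDeriv hf l).fderiv_right
      (m := ∞) (by simp)).clm_apply contDiff_const)

lemma contDiff_diffQuot {f : E → ℝ} (hf : ContDiff ℝ ∞ f) (h : ℝ) (v : E) :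
    ContDiff ℝ ∞ (diffQuot h v f) :=
  ((hf.comp (contDiff_id.add contDiff_const)).sub hf).div_const h

lemma fderiv_diffQuot {f : E → ℝ} (hf : ContDiff ℝ ∞ f) (h : ℝ) (v : E) (x w : E) :
    fderiv ℝ (diffQuot h v f) x w = diffQuot h v (fun y => fderiv ℝ f y w) x := by
  have hd : Differentiable ℝ f := hf.differentiable (by simp)
  have h1 : HasFDerivAt (fun y => f (y + h • v)) (fderiv ℝ f (x + h • v)) x :=
    (hasFDerivAt_comp_add_right (h • v)).2 (hd (x + h • v)).hasFDerivAt
  have h2 : HasFDerivAt (diffQuot h v f)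
      (h⁻¹ • (fderiv ℝ f (x + h • v) - fderiv ℝ f x)) x := by
    have := (h1.sub (hd x).hasFDerivAt).const_smul h⁻¹
    refine this.congr_of_eventuallyEq (Filter.Eventually.of_forall fun y => ?_)
    simp [diffQuot, div_eq_inv_mul]
  rw [h2.fderiv]
  simp [diffQuot, div_eq_inv_mul]

lemma iterDirDeriv_diffQuot {f : E → ℝ} (hf : ContDiff ℝ ∞ f) (h : ℝ) (v : E) :
    ∀ l : List E, iterDirDeriv l (diffQuot h v f) = diffQuot h v (iterDirDeriv l f)
  | [] => rfl
  | w :: l => by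
    funext x
    simp only [iterDirDeriv, iterDirDeriv_diffQuot hf h v l]
    exact fderiv_diffQuot (contDiff_iterDirDeriv hf l) h v x w

lemma abs_diffQuot_le {f : E → ℝ} (hf : ContDiff ℝ ∞ f) {h : ℝ} (hh : h ≠ 0) (v : E) {M : ℝ}
    (hM : ∀ x, |fderiv ℝ f x v| ≤ M) (x : E) : |diffQuot h v f x| ≤ M := by
  have hd : Differentiable ℝ f := hf.differentiable (by simp)
  have h1 : ∀ t ∈ (Set.univ : Set ℝ),
      HasDerivWithinAt (fun t : ℝ => f (x + t • v)) (fderiv ℝ f (x + t • v) v) Set.univ t := by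
    intro t _
    have h2 : HasDerivAt (fun t : ℝ => x + t • v) v t := by
      simpa using ((hasDerivAt_id t).smul_const v).const_add x
    exact ((hd _).hasFDerivAt.comp_hasDerivAt t h2).hasDerivWithinAt
  have := convex_univ.norm_image_sub_le_of_norm_hasDerivWithin_le (C := M) h1
    (fun t _ => hM _) (Set.mem_univ 0) (Set.mem_univ h)
  simp only [zero_smul, add_zero, sub_zero, Real.norm_eq_abs] at this
  rw [diffQuot, abs_div, div_le_iff₀ (abs_pos.2 hh)]
  exact this

/-- The mean value theorem for iterated difference quotients. -/
lemma abs_iterDiffQuot_le {h : ℝ} (hh : h ≠ 0) {M : ℝ} :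
    ∀ (l : List E) {f : E → ℝ}, ContDiff ℝ ∞ f → (∀ x, |iterDirDeriv l f x| ≤ M) →
      ∀ x, |iterDiffQuot h l f x| ≤ M
  | [], _, _, hM => hM
  | v :: l, f, hf, hM => by
    refine abs_iterDiffQuot_le hh l (contDiff_diffQuot hf h v) fun x => ?_
    rw [iterDirDeriv_diffQuot hf]
    exact abs_diffQuot_le (contDiff_iterDirDeriv hf l) hh v hM x

lemma iteratedFDeriv_get_eq_iterDirDeriv {f : E → ℝ} (hf : ContDiff ℝ ∞ f) :
    ∀ (l : List E) (x : E), iteratedFDeriv ℝ l.length f x l.get = iterDirDeriv l f x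
  | [], x => by simp [iterDirDeriv]
  | v :: l, x => by
    have hdiff : DifferentiableAt ℝ (iteratedFDeriv ℝ l.length f) x :=
      (hf.differentiable_iteratedFDeriv (WithTop.coe_lt_coe.2 (ENat.natCast_lt_top _))) x
    have : iterDirDeriv l f = fun y => iteratedFDeriv ℝ l.length f y l.get :=
      funext fun y => (iteratedFDeriv_get_eq_iterDirDeriv hf l y).symm
    simp only [iterDirDeriv, this]
    rw [fderiv_continuousMultilinear_apply_const_apply hdiff]
    exact iteratedFDeriv_succ_apply_left (n := l.length) (v :: l).get

lemma iterDirDeriv_comp_sub_left {ρ : E → ℝ} (hρ : ContDiff ℝ ∞ ρ) (y : E) :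
    ∀ l : List E, iterDirDeriv l (fun t => ρ (y - t)) =
      fun t => (-1) ^ l.length * iterDirDeriv l ρ (y - t)
  | [] => by simp [iterDirDeriv]
  | v :: l => by
    funext t
    have hd := (contDiff_iterDirDeriv hρ l).differentiable (by simp) (y - t)
    have h1 : HasFDerivAt (fun t => (-1) ^ l.length * iterDirDeriv l ρ (y - t))
        ((-1 : ℝ) ^ l.length • (fderiv ℝ (iterDirDeriv l ρ) (y - t)).comp
          (-ContinuousLinearMap.id ℝ E)) t :=
      (hd.hasFDerivAt.comp t ((hasFDerivAt_id t).const_sub y)).const_mul _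
    simp only [iterDirDeriv, iterDirDeriv_comp_sub_left hρ y l]
    rw [h1.fderiv]
    simp [pow_succ]

lemma iterDiffQuot_zero (h : ℝ) : ∀ l : List E, iterDiffQuot h l 0 = 0
  | [] => rfl
  | v :: l => by
    have : diffQuot h v (0 : E → ℝ) = 0 := by funext x; simp [diffQuot]
    rw [iterDiffQuot, this, iterDiffQuot_zero]

end DifferenceQuotients

section Mollification

variable {E : Type*} [NormedAddCommGroup E] [InnerProductSpace ℝ E]
  [MeasureSpace E] [BorelSpace E] [(volume : Measure E).IsAddHaarMeasure]

open Convolution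

lemma tendsto_iterDiffQuot {ι : Type*} {𝓛 : Filter ι} (h : ℝ) :
    ∀ (l : List E) {F : ι → E → ℝ} {f : E → ℝ},
      (∀ᵐ x, Filter.Tendsto (fun i => F i x) 𝓛 (nhds (f x))) →
      ∀ᵐ x, Filter.Tendsto (fun i => iterDiffQuot h l (F i) x) 𝓛 (nhds (iterDiffQuot h l f x))
  | [], _, _, hF => hF
  | v :: l, F, f, hF => by
    refine tendsto_iterDiffQuot h l ?_
    have hF' := (measurePreserving_add_right volume (h • v)).quasiMeasurePreserving.ae hF
    filter_upwards [hF, hF'] with x h1 h2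
    exact (h2.sub h1).div_const h

variable [FiniteDimensional ℝ E]

lemma iterDirDeriv_convolution {f ρ : E → ℝ} (hf : LocallyIntegrable f)
    (hρ : ContDiff ℝ ∞ ρ) (hc : HasCompactSupport ρ) :
    ∀ l : List E, HasCompactSupport (iterDirDeriv l ρ) ∧
      iterDirDeriv l (f ⋆ ρ) = f ⋆ iterDirDeriv l ρ
  | [] => ⟨hc, rfl⟩
  | v :: l => by
    obtain ⟨h1, h2⟩ := iterDirDeriv_convolution hf hρ hc l
    have hs := contDiff_iterDirDeriv hρ l
    refine ⟨h1.fderiv_apply ℝ v, ?_⟩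
    funext x
    simp only [iterDirDeriv, h2]
    rw [(h1.hasFDerivAt_convolution_right _ hf (hs.of_le (by simp)) x).fderiv,
      convolution_precompR_apply _ hf (h1.fderiv ℝ) (hs.continuous_fderiv (by simp))]

/-- If `g` is the weak derivative of `f` along `l`, then the iterated difference quotients of `f`
along `l` are bounded by the essential supremum of `g`. The derivative of the mollification
`f ⋆ ρ` along `l` is `g ⋆ ρ`. -/
lemma ae_abs_iterDiffQuot_le {f g : E → ℝ} (hf : MemLp f ∞ volume) (hg : MemLp g ∞ volume)
    (l : List E)
    (hfg : ∀ φ : E → ℝ, ContDiff ℝ ∞ φ → HasCompactSupport φ →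
        ∫ x, f x * iteratedFDeriv ℝ l.length φ x l.get = (-1) ^ l.length * ∫ x, g x * φ x)
    {h : ℝ} (hh : h ≠ 0) :
    ∀ᵐ x, |iterDiffQuot h l f x| ≤ (eLpNorm g ∞ volume).toReal := by
  set M := (eLpNorm g ∞ volume).toReal with hMdef
  have hgM : ∀ᵐ x, |g x| ≤ M := by
    have h1 : ∀ᵐ x, ‖g x‖ₑ ≤ eLpNorm g ∞ volume := by
      rw [eLpNorm_exponent_top]; exact ae_le_eLpNormEssSup
    filter_upwards [h1] with x hx
    have := ENNReal.toReal_mono hg.2.ne hx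
    simpa [hMdef] using this
  have hfl : LocallyIntegrable f := hf.locallyIntegrable (by simp)
  let ρ : ℕ → ContDiffBump (0 : E) := fun n =>
    ⟨1 / (n + 1 : ℝ), 2 / (n + 1 : ℝ), by positivity, by gcongr; norm_num⟩
  have hρ1 : Filter.Tendsto (fun n => (ρ n).rOut) Filter.atTop (nhds 0) := by
    have := (tendsto_one_div_add_atTop_nhds_zero_nat (𝕜 := ℝ)).const_mul 2
    simp only [mul_zero] at this
    refine this.congr fun n => ?_
    simp [ρ, div_eq_mul_inv]
  have hρ2 : ∀ᶠ n in Filter.atTop, (ρ n).rOut ≤ 2 * (ρ n).rIn :=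
    Filter.Eventually.of_forall fun n => by simp [ρ, div_eq_mul_inv]
  have hlim := ContDiffBump.ae_convolution_tendsto_right_of_locallyIntegrable
    (μ := (volume : Measure E)) hρ1 hρ2 hfl
  have hlim' : ∀ᵐ x, Filter.Tendsto (fun n => (f ⋆ ((ρ n).normed volume)) x)
      Filter.atTop (nhds (f x)) := by
    filter_upwards [hlim] with x hx
    refine hx.congr fun n => ?_
    rw [← convolution_flip]
    simp only [convolution_def]
    simp [mul_comm]
  filter_upwards [tendsto_iterDiffQuot h l hlim'] with x hx
  refine le_of_tendsto hx.abs (Filter.Eventually.of_forall fun n => ?_)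
  have hs : ContDiff ℝ ∞ ((ρ n).normed (volume : Measure E)) := (ρ n).contDiff_normed
  have hc : HasCompactSupport ((ρ n).normed (volume : Measure E)) := (ρ n).hasCompactSupport_normed
  refine abs_iterDiffQuot_le hh l (hc.contDiff_convolution_right (n := ⊤) _ hfl hs) (fun y => ?_) x
  have hsy : ContDiff ℝ ∞ (fun t => (ρ n).normed (volume : Measure E) (y - t)) :=
    hs.comp (contDiff_const.sub contDiff_id)
  have hcy : HasCompactSupport (fun t => (ρ n).normed (volume : Measure E) (y - t)) :=
    hc.comp_homeomorph (Homeomorph.subLeft y)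
  rw [(iterDirDeriv_convolution hfl hs hc l).2]
  have key := hfg _ hsy hcy
  simp only [iteratedFDeriv_get_eq_iterDirDeriv hsy, iterDirDeriv_comp_sub_left hs] at key
  have h3 : (f ⋆ iterDirDeriv l ((ρ n).normed (volume : Measure E))) y =
      ∫ t, g t * (ρ n).normed (volume : Measure E) (y - t) := by
    have h4 : (-1 : ℝ) ^ l.length * (-1) ^ l.length = 1 := by
      rw [← mul_pow]; simp
    rw [← one_mul (∫ t, g t * _), ← h4, mul_assoc, ← key, ← integral_const_mul]
    simp only [convolution_def]
    refine integral_congr_ae (Filter.Eventually.of_forall fun t => ?_)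
    simp only [ContinuousLinearMap.lsmul_apply, smul_eq_mul]
    linear_combination (-f t * iterDirDeriv l ((ρ n).normed (volume : Measure E)) (y - t)) * h4
  rw [h3]
  have hint : ∫ t, (ρ n).normed (volume : Measure E) (y - t) = 1 := by
    rw [integral_sub_left_eq_self (fun t => (ρ n).normed (volume : Measure E) t)]
    exact (ρ n).integral_normed
  have hI : Integrable fun t => (ρ n).normed (volume : Measure E) (y - t) :=
    (hsy.continuous.integrable_of_hasCompactSupport hcy)
  calc |∫ t, g t * (ρ n).normed (volume : Measure E) (y - t)|
      ≤ ∫ t, M * (ρ n).normed (volume : Measure E) (y - t) := by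
        rw [← Real.norm_eq_abs]
        refine norm_integral_le_of_norm_le (hI.const_mul M) ?_
        filter_upwards [hgM] with t ht
        rw [norm_mul, Real.norm_of_nonneg ((ρ n).nonneg_normed _)]
        exact mul_le_mul_of_nonneg_right ht ((ρ n).nonneg_normed _)
    _ = M := by rw [integral_const_mul, hint, mul_one]

end Mollification

/-! ### Translations, isometries and the Fourier transform on `L²` -/

section FourierL2

variable {E : Type*} [NormedAddCommGroup E] [InnerProductSpace ℝ E] [FiniteDimensional ℝ E]
  [MeasurableSpace E] [BorelSpace E]

/-- The translation `f ↦ f(· + v)` on `L²`. -/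
def translate (v : E) : Lp (α := E) ℂ 2 →+ Lp (α := E) ℂ 2 :=
  Lp.compMeasurePreserving (fun x => x + v) (measurePreserving_add_right volume v)

lemma coeFn_translate (v : E) (f : Lp (α := E) ℂ 2) :
    translate v f =ᵐ[volume] fun x => f (x + v) :=
  Lp.coeFn_compMeasurePreserving f (measurePreserving_add_right volume v)

lemma continuous_translate (v : E) : Continuous (translate v) :=
  (Lp.isometry_compMeasurePreserving (measurePreserving_add_right volume v)).continuous

/-- An identity `𝓕 (T f) = M (𝓕 f)` between continuous maps of `L²` holds if it holds for
Schwartz functions. -/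
lemma fourier_eq_of_schwartz {T M : Lp (α := E) ℂ 2 → Lp (α := E) ℂ 2} (hT : Continuous T)
    (hM : Continuous M)
    (h : ∀ f : SchwartzMap E ℂ, 𝓕 (T (f.toLp 2)) = M ((𝓕 f : SchwartzMap E ℂ).toLp 2))
    (f : Lp (α := E) ℂ 2) :
    𝓕 (T f) = M (𝓕 f) := by
  have hF : Continuous fun f : Lp (α := E) ℂ 2 => 𝓕 f :=
    (Lp.fourierTransformₗᵢ E ℂ).continuous
  refine DenseRange.induction_on (p := fun f : Lp (α := E) ℂ 2 => 𝓕 (T f) = M (𝓕 f))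
    (SchwartzMap.denseRange_toLpCLM (F := ℂ) (p := 2) (μ := volume) ENNReal.ofNat_ne_top) f
    (isClosed_eq (hF.comp hT) (hM.comp hF)) fun f => ?_
  simpa using h f

lemma fourier_translate (v : E) (f : Lp (α := E) ℂ 2) :
    (𝓕 (translate v f) : Lp (α := E) ℂ 2 (volume : Measure E)) =ᵐ[(volume : Measure E)]
      fun ξ => ((Real.fourierChar (inner ℝ v ξ) : Circle) : ℂ) *
        (𝓕 f : Lp (α := E) ℂ 2 (volume : Measure E)) ξ := by
  have hc : Continuous fun ξ : E => ((Real.fourierChar (inner ℝ v ξ) : Circle) : ℂ) := by fun_prop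
  have hm : MemLp (fun ξ : E => ((Real.fourierChar (inner ℝ v ξ) : Circle) : ℂ)) ∞ volume :=
    memLp_top_of_bound hc.aestronglyMeasurable 1
      (Filter.Eventually.of_forall fun ξ => (Circle.norm_coe _).le)
  let B := (ContinuousLinearMap.mul ℂ ℂ)
  have hM : Continuous (B.holderL volume ∞ 2 2 hm.toLp) := ContinuousLinearMap.continuous _
  have hB (g : Lp (α := E) ℂ 2) : B.holderL volume ∞ 2 2 hm.toLp g =ᵐ[volume]
      fun ξ => ((Real.fourierChar (inner ℝ v ξ) : Circle) : ℂ) * g ξ := by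
    refine (B.coeFn_holder hm.toLp g).trans ?_
    filter_upwards [hm.coeFn_toLp] with ξ hξ
    simp [B, hξ]
  rw [fourier_eq_of_schwartz (continuous_translate v) hM]
  · exact hB _
  intro f
  have h1 : translate v (f.toLp 2) = (f.compSubConstCLM ℂ (-v)).toLp 2 := by
    refine Lp.ext ?_
    have h2 := (measurePreserving_add_right volume v).quasiMeasurePreserving.ae_eq_comp
      (f.coeFn_toLp 2)
    filter_upwards [coeFn_translate v (f.toLp 2), h2,
      (f.compSubConstCLM ℂ (-v)).coeFn_toLp 2] with x h3 h4 h5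
    simp only [Function.comp_apply] at h4
    rw [h3, h5, h4]
    simp
  rw [h1, SchwartzMap.toLp_fourier_eq]
  refine Lp.ext ?_
  filter_upwards [hB ((𝓕 f : SchwartzMap E ℂ).toLp 2), (𝓕 f).coeFn_toLp 2,
    (𝓕 (f.compSubConstCLM ℂ (-v))).coeFn_toLp 2] with ξ h3 h4 h5
  rw [h3, h4, h5, SchwartzMap.fourier_coe, SchwartzMap.fourier_coe]
  have h6 : ⇑(f.compSubConstCLM ℂ (-v)) = ⇑f ∘ fun x => x + v := by
    funext x; simp
  rw [h6]
  have := congrFun (VectorFourier.fourierIntegral_comp_add_right Real.fourierChar volume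
    (innerₗ E) f v) ξ
  rw [Circle.smul_def, smul_eq_mul] at this
  exact this

lemma fourier_comp_isometry (A : E ≃ₗᵢ[ℝ] E) (f : Lp (α := E) ℂ 2) :
    (𝓕 (Lp.compMeasurePreserving A A.measurePreserving f) : Lp (α := E) ℂ 2) =
      Lp.compMeasurePreserving A A.measurePreserving (𝓕 f) := by
  have hT : Continuous (Lp.compMeasurePreserving A A.measurePreserving :
      Lp (α := E) ℂ 2 →+ Lp (α := E) ℂ 2) :=
    (Lp.isometry_compMeasurePreserving A.measurePreserving).continuous
  refine fourier_eq_of_schwartz hT hT (fun f => ?_) f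
  have h1 (f : SchwartzMap E ℂ) : Lp.compMeasurePreserving A A.measurePreserving (f.toLp 2) =
      (SchwartzMap.compCLMOfContinuousLinearEquiv ℂ A.toContinuousLinearEquiv f).toLp 2 := by
    refine Lp.ext ?_
    have h2 := A.measurePreserving.quasiMeasurePreserving.ae_eq_comp (f.coeFn_toLp 2)
    filter_upwards [Lp.coeFn_compMeasurePreserving (f.toLp 2) A.measurePreserving, h2,
      (SchwartzMap.compCLMOfContinuousLinearEquiv ℂ A.toContinuousLinearEquiv f).coeFn_toLp 2]
      with x h3 h4 h5
    simp only [Function.comp_apply] at h3 h4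
    rw [h3, h5, h4]
    simp
  rw [h1, h1, SchwartzMap.toLp_fourier_eq]
  congr 1
  ext ξ
  simp only [SchwartzMap.fourier_coe, SchwartzMap.compCLMOfContinuousLinearEquiv_apply]
  exact Real.fourier_comp_linearIsometry A f ξ

end FourierL2

/-! ### Quadratic forms of bounded Fourier multipliers -/

section MultiplierForms

/-- A bounded measurable weight. -/
def IsBddWeight {E : Type*} [MeasurableSpace E] (m : E → ℝ) : Prop :=
  Measurable m ∧ ∃ C, ∀ ξ, |m ξ| ≤ C

namespace IsBddWeight

variable {E : Type*} [MeasurableSpace E] {m₁ m₂ : E → ℝ}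

lemma const (c : ℝ) : IsBddWeight fun _ : E => c := ⟨measurable_const, |c|, fun _ => le_rfl⟩

lemma add (h₁ : IsBddWeight m₁) (h₂ : IsBddWeight m₂) : IsBddWeight fun ξ => m₁ ξ + m₂ ξ := by
  obtain ⟨hm₁, C₁, hC₁⟩ := h₁
  obtain ⟨hm₂, C₂, hC₂⟩ := h₂
  exact ⟨hm₁.add hm₂, C₁ + C₂, fun ξ => (abs_add_le _ _).trans (add_le_add (hC₁ ξ) (hC₂ ξ))⟩

lemma mul (h₁ : IsBddWeight m₁) (h₂ : IsBddWeight m₂) : IsBddWeight fun ξ => m₁ ξ * m₂ ξ := by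
  obtain ⟨hm₁, C₁, hC₁⟩ := h₁
  obtain ⟨hm₂, C₂, hC₂⟩ := h₂
  refine ⟨hm₁.mul hm₂, C₁ * C₂, fun ξ => ?_⟩
  rw [abs_mul]
  exact mul_le_mul (hC₁ ξ) (hC₂ ξ) (abs_nonneg _) ((abs_nonneg _).trans (hC₁ ξ))

lemma sq (h₁ : IsBddWeight m₁) : IsBddWeight fun ξ => m₁ ξ ^ 2 := by
  simpa only [pow_two] using h₁.mul h₁

lemma sum {ι : Type*} (s : Finset ι) {m : ι → E → ℝ} (h : ∀ i, IsBddWeight (m i)) :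
    IsBddWeight fun ξ => ∑ i ∈ s, m i ξ := by
  classical
  induction s using Finset.induction_on with
  | empty => simpa using const 0
  | insert a s ha ih => simpa only [Finset.sum_insert ha] using (h a).add ih

lemma prod {ι : Type*} (s : Finset ι) {m : ι → E → ℝ} (h : ∀ i, IsBddWeight (m i)) :
    IsBddWeight fun ξ => ∏ i ∈ s, m i ξ := by
  classical
  induction s using Finset.induction_on with
  | empty => simpa using const 1
  | insert a s ha ih => simpa only [Finset.prod_insert ha] using (h a).mul ih

end IsBddWeight

variable {d N : ℕ}

/-- The real part of `⟨f, m(-i∇) g⟩`, for the Fourier multiplier with symbol `m`. -/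
def multForm (m : Config d N → ℝ) (f g : WaveFn d N) : ℝ :=
  ∫ ξ, m ξ * inner ℝ (𝓕 f ξ) (𝓕 g ξ)

lemma integrable_weight_inner {m : Config d N → ℝ} (hm : IsBddWeight m) (F G : WaveFn d N) :
    Integrable fun ξ => m ξ * inner ℝ (F ξ) (G ξ) := by
  obtain ⟨hm, C, hC⟩ := hm
  have h := L2.integrable_inner (𝕜 := ℝ) F G
  exact h.bdd_mul (c := C) hm.aestronglyMeasurable (Filter.Eventually.of_forall hC)

lemma multForm_add_right {m : Config d N → ℝ} (hm : IsBddWeight m) (f g₁ g₂ : WaveFn d N) :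
    multForm m f (g₁ + g₂) = multForm m f g₁ + multForm m f g₂ := by
  unfold multForm
  rw [← integral_add (integrable_weight_inner hm _ _) (integrable_weight_inner hm _ _)]
  refine integral_congr_ae ?_
  rw [FourierAdd.fourier_add]
  filter_upwards [Lp.coeFn_add (𝓕 g₁ : WaveFn d N) (𝓕 g₂ : WaveFn d N)] with ξ h
  rw [h, Pi.add_apply, inner_add_right, mul_add]

lemma multForm_smul_right (m : Config d N → ℝ) (c : ℝ) (f g : WaveFn d N) :
    multForm m f ((c : ℂ) • g) = c * multForm m f g := by
  unfold multForm
  rw [← integral_const_mul]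
  refine integral_congr_ae ?_
  rw [FourierSMul.fourier_smul]
  filter_upwards [Lp.coeFn_smul (c : ℂ) (𝓕 g : WaveFn d N)] with ξ h
  rw [h, Pi.smul_apply, Complex.coe_smul, inner_smul_right]
  ring

lemma multForm_zero_right (m : Config d N → ℝ) (f : WaveFn d N) : multForm m f 0 = 0 := by
  simpa using multForm_smul_right m 0 f 0

lemma multForm_sum_right {ι : Type*} (s : Finset ι) {m : Config d N → ℝ} (hm : IsBddWeight m)
    (f : WaveFn d N) (g : ι → WaveFn d N) :
    multForm m f (∑ i ∈ s, g i) = ∑ i ∈ s, multForm m f (g i) := by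
  classical
  induction s using Finset.induction_on with
  | empty => simpa using multForm_zero_right m f
  | insert a s ha ih => rw [Finset.sum_insert ha, Finset.sum_insert ha, multForm_add_right hm, ih]

lemma multForm_add_weight {m₁ m₂ : Config d N → ℝ} (h₁ : IsBddWeight m₁) (h₂ : IsBddWeight m₂)
    (f g : WaveFn d N) :
    multForm (fun ξ => m₁ ξ + m₂ ξ) f g = multForm m₁ f g + multForm m₂ f g := by
  unfold multForm
  rw [← integral_add (integrable_weight_inner h₁ _ _) (integrable_weight_inner h₂ _ _)]
  simp only [add_mul]

lemma multForm_const_mul_weight (c : ℝ) (m : Config d N → ℝ) (f g : WaveFn d N) :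
    multForm (fun ξ => c * m ξ) f g = c * multForm m f g := by
  unfold multForm
  rw [← integral_const_mul]
  simp only [mul_assoc]

lemma multForm_sum_weight {ι : Type*} (s : Finset ι) {m : ι → Config d N → ℝ}
    (hm : ∀ i, IsBddWeight (m i)) (f g : WaveFn d N) :
    multForm (fun ξ => ∑ i ∈ s, m i ξ) f g = ∑ i ∈ s, multForm (m i) f g := by
  unfold multForm
  simp only [Finset.sum_mul]
  exact integral_finsetSum s fun i _ => integrable_weight_inner (hm i) _ _

lemma multForm_self_mono {m₁ m₂ : Config d N → ℝ} (h₁ : IsBddWeight m₁) (h₂ : IsBddWeight m₂)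
    (h : ∀ ξ, m₁ ξ ≤ m₂ ξ) (f : WaveFn d N) : multForm m₁ f f ≤ multForm m₂ f f :=
  integral_mono (integrable_weight_inner h₁ _ _) (integrable_weight_inner h₂ _ _) fun ξ =>
    mul_le_mul_of_nonneg_right (h ξ) real_inner_self_nonneg

lemma multForm_self_nonneg {m : Config d N → ℝ} (h : ∀ ξ, 0 ≤ m ξ) (f : WaveFn d N) :
    0 ≤ multForm m f f :=
  integral_nonneg fun ξ => mul_nonneg (h ξ) real_inner_self_nonneg

/-- The Cauchy–Schwarz inequality for the form with weight `m₁`, in its additive form. -/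
lemma abs_multForm_mul_le {m₁ m₂ : Config d N → ℝ} (h₁ : IsBddWeight m₁) (h₂ : IsBddWeight m₂)
    (hpos : ∀ ξ, 0 ≤ m₁ ξ) {ε : ℝ} (hε : 0 < ε) (f g : WaveFn d N) :
    |multForm (fun ξ => m₁ ξ * m₂ ξ) f g| ≤
      ε / 2 * multForm (fun ξ => m₁ ξ * m₂ ξ ^ 2) f f + 1 / (2 * ε) * multForm m₁ g g := by
  rw [← multForm_const_mul_weight, ← multForm_const_mul_weight]
  unfold multForm
  have hI₁ := integrable_weight_inner ((IsBddWeight.const (ε / 2)).mul (h₁.mul h₂.sq)) (𝓕 f) (𝓕 f)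
  have hI₂ := integrable_weight_inner ((IsBddWeight.const (1 / (2 * ε))).mul h₁) (𝓕 g) (𝓕 g)
  rw [← integral_add hI₁ hI₂, ← Real.norm_eq_abs]
  refine norm_integral_le_of_norm_le (hI₁.add hI₂) (Filter.Eventually.of_forall fun ξ => ?_)
  simp only [Real.norm_eq_abs, abs_mul, abs_of_nonneg (hpos ξ), real_inner_self_eq_norm_sq]
  have h3 := abs_real_inner_le_norm ((𝓕 f : WaveFn d N) ξ) ((𝓕 g : WaveFn d N) ξ)
  set a := ‖(𝓕 f : WaveFn d N) ξ‖
  set b := ‖(𝓕 g : WaveFn d N) ξ‖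
  have h4 : |m₂ ξ| * (a * b) ≤ ε / 2 * (m₂ ξ ^ 2 * a ^ 2) + 1 / (2 * ε) * b ^ 2 := by
    have h5 : 0 ≤ (ε * (|m₂ ξ| * a) - b) ^ 2 / (2 * ε) := by positivity
    have h6 : (ε * (|m₂ ξ| * a) - b) ^ 2 / (2 * ε) =
        ε / 2 * (m₂ ξ ^ 2 * a ^ 2) + 1 / (2 * ε) * b ^ 2 - |m₂ ξ| * (a * b) := by
      rw [← sq_abs (m₂ ξ)]
      field_simp
      ring
    linarith
  calc m₁ ξ * |m₂ ξ| * |inner ℝ ((𝓕 f : WaveFn d N) ξ) ((𝓕 g : WaveFn d N) ξ)|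
      ≤ m₁ ξ * |m₂ ξ| * (a * b) :=
        mul_le_mul_of_nonneg_left h3 (mul_nonneg (hpos ξ) (abs_nonneg _))
    _ ≤ m₁ ξ * (ε / 2 * (m₂ ξ ^ 2 * a ^ 2) + 1 / (2 * ε) * b ^ 2) := by
        rw [mul_assoc]
        exact mul_le_mul_of_nonneg_left h4 (hpos ξ)
    _ = _ := by ring

lemma multForm_add_self_le {m : Config d N → ℝ} (hm : IsBddWeight m) (hpos : ∀ ξ, 0 ≤ m ξ)
    (f g : WaveFn d N) :
    multForm m (f + g) (f + g) ≤ 2 * multForm m f f + 2 * multForm m g g := by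
  unfold multForm
  rw [← integral_const_mul, ← integral_const_mul]
  have hI₁ := (integrable_weight_inner hm (𝓕 f) (𝓕 f)).const_mul 2
  have hI₂ := (integrable_weight_inner hm (𝓕 g) (𝓕 g)).const_mul 2
  rw [← integral_add hI₁ hI₂]
  refine integral_mono_ae (integrable_weight_inner hm _ _) (hI₁.add hI₂) ?_
  rw [FourierAdd.fourier_add]
  filter_upwards [Lp.coeFn_add (𝓕 f : WaveFn d N) (𝓕 g : WaveFn d N)] with ξ h
  simp only [h, Pi.add_apply, real_inner_self_eq_norm_sq]
  have h1 := norm_add_le ((𝓕 f : WaveFn d N) ξ) ((𝓕 g : WaveFn d N) ξ)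
  have h2 : ‖(𝓕 f : WaveFn d N) ξ + (𝓕 g : WaveFn d N) ξ‖ ^ 2 ≤
      2 * ‖(𝓕 f : WaveFn d N) ξ‖ ^ 2 + 2 * ‖(𝓕 g : WaveFn d N) ξ‖ ^ 2 := by
    have := pow_le_pow_left₀ (norm_nonneg _) h1 2
    nlinarith [sq_nonneg (‖(𝓕 f : WaveFn d N) ξ‖ - ‖(𝓕 g : WaveFn d N) ξ‖)]
  nlinarith [mul_le_mul_of_nonneg_left h2 (hpos ξ)]

lemma multForm_one (f g : WaveFn d N) :
    multForm (fun _ => 1) f g = ∫ x, inner ℝ (f x) (g x) := by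
  have h := congrArg Complex.re (Lp.inner_fourier_eq f g)
  rw [L2.inner_def, L2.inner_def] at h
  have h2 (u v : WaveFn d N) :
      (∫ x, inner ℂ (u x) (v x)).re = ∫ x, inner ℝ (u x) (v x) := by
    have := integral_re (L2.integrable_inner (𝕜 := ℂ) u v)
    rw [← RCLike.re_eq_complex_re, ← this]
    rfl
  rw [h2, h2] at h
  simpa [multForm] using h

/-! ### Discrete derivatives -/

/-- The symbol `|(e^{2πiht} - 1) / h|²` of minus the discrete second derivative. -/
def diffSymbol (h t : ℝ) : ℝ := ‖((Real.fourierChar (h * t) : Circle) : ℂ) - 1‖ ^ 2 / h ^ 2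

/-- The difference quotient in the coordinate `e`, acting on `L²`. -/
def waveDiff (h : ℝ) (e : Fin N × Fin d) (f : WaveFn d N) : WaveFn d N :=
  ((h⁻¹ : ℝ) : ℂ) • (translate (h • EuclideanSpace.single e (1 : ℝ)) f - f)

/-- The symbol of `1 - Δ_{x_i}` with the Laplacian replaced by the discrete one of step `h`. -/
def discreteSymbol (h : ℝ) (i : Fin N) (ξ : Config d N) : ℝ :=
  1 + ∑ a, diffSymbol h (ξ (i, a))

/-- The symbol of the product over `i ∈ J` of the discrete `1 - Δ_{x_i}`. -/
def discreteWeight (h : ℝ) (J : Finset (Fin N)) (ξ : Config d N) : ℝ :=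
  ∏ i ∈ J, discreteSymbol h i ξ

lemma coeFn_waveDiff (h : ℝ) (e : Fin N × Fin d) (f : WaveFn d N) :
    waveDiff h e f =ᵐ[volume]
      fun x => ((h⁻¹ : ℝ) : ℂ) * (f (x + h • EuclideanSpace.single e (1 : ℝ)) - f x) := by
  unfold waveDiff
  filter_upwards [Lp.coeFn_smul ((h⁻¹ : ℝ) : ℂ)
      (translate (h • EuclideanSpace.single e (1 : ℝ)) f - f),
    Lp.coeFn_sub (translate (h • EuclideanSpace.single e (1 : ℝ)) f) f,
    coeFn_translate (h • EuclideanSpace.single e (1 : ℝ)) f] with x h1 h2 h3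
  rw [h1, Pi.smul_apply, h2, Pi.sub_apply, h3, smul_eq_mul]

lemma fourier_waveDiff (h : ℝ) (e : Fin N × Fin d) (f : WaveFn d N) :
    (𝓕 (waveDiff h e f) : WaveFn d N) =ᵐ[volume]
      fun ξ => ((h⁻¹ : ℝ) : ℂ) * (((Real.fourierChar (h * ξ e) : Circle) : ℂ) - 1) *
        (𝓕 f : WaveFn d N) ξ := by
  have h0 : (𝓕 (waveDiff h e f) : WaveFn d N) = ((h⁻¹ : ℝ) : ℂ) •
      (𝓕 (translate (h • EuclideanSpace.single e (1 : ℝ)) f) - 𝓕 f : WaveFn d N) := by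
    unfold waveDiff
    rw [FourierSMul.fourier_smul, sub_eq_add_neg, FourierAdd.fourier_add, sub_eq_add_neg]
    congr 2
    exact (Lp.fourierTransformₗᵢ (Config d N) ℂ).map_neg f
  rw [h0]
  filter_upwards [Lp.coeFn_smul ((h⁻¹ : ℝ) : ℂ)
      (𝓕 (translate (h • EuclideanSpace.single e (1 : ℝ)) f) - 𝓕 f : WaveFn d N),
    Lp.coeFn_sub (𝓕 (translate (h • EuclideanSpace.single e (1 : ℝ)) f) : WaveFn d N)
      (𝓕 f : WaveFn d N),
    fourier_translate (h • EuclideanSpace.single e (1 : ℝ) : Config d N) f] with x h1 h2 h3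
  rw [h1, Pi.smul_apply, h2, Pi.sub_apply, h3, smul_eq_mul, real_inner_smul_left,
    EuclideanSpace.inner_single_left]
  simp
  ring

lemma multForm_translate (m : Config d N → ℝ) (v : Config d N) (f : WaveFn d N) :
    multForm m (translate v f) (translate v f) = multForm m f f := by
  unfold multForm
  refine integral_congr_ae ?_
  filter_upwards [fourier_translate v f] with ξ h
  simp only [real_inner_self_eq_norm_sq, h, norm_mul, Circle.norm_coe, one_mul]

lemma multForm_waveDiff (m : Config d N → ℝ) (h : ℝ) (e : Fin N × Fin d) (f g : WaveFn d N) :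
    multForm m (waveDiff h e f) (waveDiff h e g) =
      multForm (fun ξ => m ξ * diffSymbol h (ξ e)) f g := by
  unfold multForm
  refine integral_congr_ae ?_
  filter_upwards [fourier_waveDiff h e f, fourier_waveDiff h e g] with ξ h1 h2
  have h3 (c z w : ℂ) : inner ℝ (c * z) (c * w) = ‖c‖ ^ 2 * inner ℝ z w := by
    rw [← Complex.normSq_eq_norm_sq]
    simp [Complex.inner, Complex.normSq_apply]
    ring
  rw [h1, h2, h3, norm_mul, mul_pow, diffSymbol, Complex.norm_real, Real.norm_eq_abs, sq_abs]
  ring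

lemma diffSymbol_nonneg (h t : ℝ) : 0 ≤ diffSymbol h t := by unfold diffSymbol; positivity

lemma norm_fourierChar_sub_one (x : ℝ) :
    ‖((Real.fourierChar x : Circle) : ℂ) - 1‖ = ‖2 * Real.sin (Real.pi * x)‖ := by
  rw [Real.fourierChar_apply, mul_comm _ Complex.I, Complex.norm_exp_I_mul_ofReal_sub_one]
  congr 3
  ring

lemma diffSymbol_le (h t : ℝ) : diffSymbol h t ≤ (2 * Real.pi * t) ^ 2 := by
  rcases eq_or_ne h 0 with rfl | hh
  · simp [diffSymbol]; positivity
  rw [diffSymbol, div_le_iff₀ (by positivity), norm_fourierChar_sub_one, Real.norm_eq_abs, sq_abs,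
    mul_pow]
  have h1 : Real.sin (Real.pi * (h * t)) ^ 2 ≤ (Real.pi * (h * t)) ^ 2 :=
    sq_le_sq.2 (Real.abs_sin_le_abs)
  nlinarith

lemma diffSymbol_le_const (h t : ℝ) : diffSymbol h t ≤ 4 / h ^ 2 := by
  unfold diffSymbol
  gcongr
  rw [norm_fourierChar_sub_one, Real.norm_eq_abs, sq_abs]
  nlinarith [Real.sin_sq_le_one (Real.pi * (h * t))]

lemma measurable_diffSymbol (h : ℝ) (e : Fin N × Fin d) :
    Measurable fun ξ : Config d N => diffSymbol h (ξ e) := by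
  unfold diffSymbol
  have : Continuous fun ξ : Config d N => ((Real.fourierChar (h * ξ e) : Circle) : ℂ) := by
    fun_prop
  exact (((this.sub continuous_const).norm.pow 2).div_const _).measurable

lemma isBddWeight_diffSymbol (h : ℝ) (e : Fin N × Fin d) :
    IsBddWeight fun ξ : Config d N => diffSymbol h (ξ e) :=
  ⟨measurable_diffSymbol h e, 4 / h ^ 2, fun ξ => by
    rw [abs_of_nonneg (diffSymbol_nonneg _ _)]; exact diffSymbol_le_const h _⟩

lemma isBddWeight_discreteSymbol (h : ℝ) (i : Fin N) :
    IsBddWeight (discreteSymbol h i : Config d N → ℝ) :=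
  (IsBddWeight.const 1).add (IsBddWeight.sum _ fun _ => isBddWeight_diffSymbol h _)

lemma isBddWeight_discreteWeight (h : ℝ) (J : Finset (Fin N)) :
    IsBddWeight (discreteWeight h J : Config d N → ℝ) :=
  IsBddWeight.prod J fun i => isBddWeight_discreteSymbol h i

lemma one_le_discreteSymbol (h : ℝ) (i : Fin N) (ξ : Config d N) : 1 ≤ discreteSymbol h i ξ :=
  le_add_of_nonneg_right (Finset.sum_nonneg fun _ _ => diffSymbol_nonneg _ _)

lemma discreteSymbol_le (h : ℝ) (i : Fin N) (ξ : Config d N) :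
    discreteSymbol h i ξ ≤ 1 + laplaceSymbol ξ i := by
  unfold discreteSymbol laplaceSymbol
  rw [mul_pow, EuclideanSpace.norm_sq_eq, Finset.mul_sum]
  gcongr with a
  rw [Real.norm_eq_abs, sq_abs, ← mul_pow]
  exact diffSymbol_le h _

lemma discreteWeight_pos (h : ℝ) (J : Finset (Fin N)) (ξ : Config d N) :
    0 < discreteWeight h J ξ :=
  Finset.prod_pos fun i _ => one_pos.trans_le (one_le_discreteSymbol h i ξ)

lemma tendsto_diffSymbol (t : ℝ) :
    Filter.Tendsto (fun h => diffSymbol h t) (nhdsWithin 0 {0}ᶜ)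
      (nhds ((2 * Real.pi * t) ^ 2)) := by
  have h1 : HasDerivAt (fun h : ℝ => 2 * Real.sin (Real.pi * (h * t))) (2 * Real.pi * t) 0 := by
    have h2 : HasDerivAt (fun h : ℝ => Real.pi * (h * t)) (Real.pi * (1 * t)) 0 :=
      ((hasDerivAt_id (0 : ℝ)).mul_const t).const_mul Real.pi
    have h3 := h2.sin.const_mul 2
    simp at h3
    convert! h3 using 1
    ring
  have h4 := (hasDerivAt_iff_tendsto_slope_zero.1 h1).pow 2
  refine h4.congr fun h => ?_
  rw [diffSymbol, norm_fourierChar_sub_one, Real.norm_eq_abs, sq_abs]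
  simp [mul_pow, div_eq_inv_mul]

lemma tendsto_discreteSymbol (i : Fin N) (ξ : Config d N) :
    Filter.Tendsto (fun h => discreteSymbol h i ξ) (nhdsWithin 0 {0}ᶜ)
      (nhds (1 + laplaceSymbol ξ i)) := by
  unfold laplaceSymbol
  rw [mul_pow, EuclideanSpace.norm_sq_eq, Finset.mul_sum]
  refine tendsto_const_nhds.add (tendsto_finsetSum _ fun a _ => ?_)
  rw [Real.norm_eq_abs, sq_abs, ← mul_pow]
  exact tendsto_diffSymbol _

/-- Adding a particle to the weight adds one difference quotient in that particle. -/
lemma multForm_discreteWeight_insert (h : ℝ) {i : Fin N} {J : Finset (Fin N)} (hi : i ∉ J)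
    (f g : WaveFn d N) :
    multForm (discreteWeight h (insert i J)) f g = multForm (discreteWeight h J) f g +
      ∑ a, multForm (discreteWeight h J) (waveDiff h (i, a) f) (waveDiff h (i, a) g) := by
  simp only [multForm_waveDiff]
  have hb := isBddWeight_discreteWeight (d := d) h J
  rw [← multForm_sum_weight _ fun a => hb.mul (isBddWeight_diffSymbol h (i, a)),
    ← multForm_add_weight hb (IsBddWeight.sum _ fun a => hb.mul (isBddWeight_diffSymbol h (i, a)))]
  congr 1
  funext ξ
  rw [discreteWeight, Finset.prod_insert hi, ← Finset.mul_sum, discreteSymbol, discreteWeight]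
  ring

end MultiplierForms

/-! ### Multiplication operators and discrete derivatives -/

section Multiplication

variable {d N : ℕ}

lemma exists_mul_waveFn {U : Config d N → ℝ} (hU : AEStronglyMeasurable U) {M : ℝ}
    (hM : ∀ᵐ x, |U x| ≤ M) (f : WaveFn d N) :
    ∃ g : WaveFn d N, ∀ᵐ x, g x = (U x : ℂ) * f x := by
  have hmem : MemLp (fun x => (U x : ℂ)) ∞ volume := by
    refine memLp_top_of_bound (Complex.continuous_ofReal.comp_aestronglyMeasurable hU) M ?_
    filter_upwards [hM] with x hx
    simpa using hx
  exact ⟨((Lp.memLp f).mul hmem).toLp, MemLp.coeFn_toLp _⟩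

lemma discreteWeight_empty (h : ℝ) : (discreteWeight h ∅ : Config d N → ℝ) = fun _ => 1 := by
  funext ξ
  simp [discreteWeight]

/-- A non-negative potential which does not depend on the particles in `J` commutes with the
discrete derivatives in these particles. -/
lemma multForm_mul_nonneg {h : ℝ} {U : Config d N → ℝ} (hU : ∀ᵐ x, 0 ≤ U x)
    (J : Finset (Fin N))
    (hinv : ∀ i ∈ J, ∀ a, ∀ x, U (x + h • EuclideanSpace.single (i, a) (1 : ℝ)) = U x) :
    ∀ f g : WaveFn d N, (∀ᵐ x, g x = (U x : ℂ) * f x) →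
      0 ≤ multForm (discreteWeight h J) f g := by
  induction J using Finset.induction_on with
  | empty =>
    intro f g hg
    rw [discreteWeight_empty, multForm_one]
    refine integral_nonneg_of_ae ?_
    filter_upwards [hU, hg] with x h1 h2
    rw [h2, ← Complex.real_smul, real_inner_smul_right]
    exact mul_nonneg h1 real_inner_self_nonneg
  | insert i J hi ih =>
    intro f g hg
    have ih' := ih fun j hj => hinv j (Finset.mem_insert_of_mem hj)
    rw [multForm_discreteWeight_insert h hi]
    refine add_nonneg (ih' f g hg) (Finset.sum_nonneg fun a _ => ih' _ _ ?_)
    have hg' := (measurePreserving_add_right (volume : Measure (Config d N))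
      (h • EuclideanSpace.single (i, a) (1 : ℝ))).quasiMeasurePreserving.ae hg
    filter_upwards [hg, hg', coeFn_waveDiff h (i, a) f, coeFn_waveDiff h (i, a) g]
      with x h1 h2 h3 h4
    rw [h3, h4, h1, h2, hinv i (Finset.mem_insert_self i J) a x]
    ring

/-- `U` is measurable and its iterated difference quotients of step `h`, in at most one coordinate
of each particle of `J`, are bounded by `M`. -/
def HasDiffBound (h : ℝ) (J : Finset (Fin N)) (U : Config d N → ℝ) (M : ℝ) : Prop :=
  AEStronglyMeasurable U ∧ ∀ l : List (Fin N × Fin d), (l.map Prod.fst).Nodup →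
    (∀ e ∈ l, e.1 ∈ J) →
      ∀ᵐ x, |iterDiffQuot h (l.map fun e => EuclideanSpace.single e (1 : ℝ)) U x| ≤ M

lemma HasDiffBound.mono {h : ℝ} {J J' : Finset (Fin N)} {U : Config d N → ℝ} {M : ℝ}
    (hU : HasDiffBound h J' U M) (hJ : J ⊆ J') : HasDiffBound h J U M :=
  ⟨hU.1, fun l h1 h2 => hU.2 l h1 fun e he => hJ (h2 e he)⟩

lemma HasDiffBound.diffQuot {h : ℝ} {i : Fin N} {J : Finset (Fin N)} (hi : i ∉ J)
    {U : Config d N → ℝ} {M : ℝ} (hU : HasDiffBound h (insert i J) U M) (a : Fin d) :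
    HasDiffBound h J (diffQuot h (EuclideanSpace.single (i, a) (1 : ℝ)) U) M := by
  refine ⟨?_, fun l h1 h2 => ?_⟩
  · have h3 := hU.1.comp_quasiMeasurePreserving (measurePreserving_add_right
      (volume : Measure (Config d N))
      (h • EuclideanSpace.single (i, a) (1 : ℝ))).quasiMeasurePreserving
    have h4 : ManyBody.diffQuot h (EuclideanSpace.single (i, a) (1 : ℝ)) U =
        h⁻¹ • ((U ∘ fun x => x + h • EuclideanSpace.single (i, a) (1 : ℝ)) - U) := by
      funext x
      simp [ManyBody.diffQuot, div_eq_inv_mul]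
    rw [h4]
    exact (h3.sub hU.1).const_smul h⁻¹
  · refine hU.2 ((i, a) :: l) ?_ ?_
    · rw [List.map_cons, List.nodup_cons]
      refine ⟨fun hmem => ?_, h1⟩
      obtain ⟨e, he, hei⟩ := List.mem_map.1 hmem
      simp only at hei
      exact hi (hei ▸ h2 e he)
    · intro e he
      rcases List.mem_cons.1 he with rfl | he
      · exact Finset.mem_insert_self _ _
      · exact Finset.mem_insert_of_mem (h2 e he)

/-- The discrete product rule `D (U f) = (D U) (τ f) + U (D f)`. -/
lemma waveDiff_mul {h : ℝ} {e : Fin N × Fin d} {U : Config d N → ℝ} {f g u₁ u₂ : WaveFn d N}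
    (hg : ∀ᵐ x, g x = (U x : ℂ) * f x)
    (hu₁ : ∀ᵐ x, u₁ x = (ManyBody.diffQuot h (EuclideanSpace.single e (1 : ℝ)) U x : ℂ) *
      translate (h • EuclideanSpace.single e (1 : ℝ)) f x)
    (hu₂ : ∀ᵐ x, u₂ x = (U x : ℂ) * waveDiff h e f x) :
    waveDiff h e g = u₁ + u₂ := by
  refine Lp.ext ?_
  have hg' := (measurePreserving_add_right (volume : Measure (Config d N))
    (h • EuclideanSpace.single e (1 : ℝ))).quasiMeasurePreserving.ae hg
  filter_upwards [hg, hg', coeFn_waveDiff h e f, coeFn_waveDiff h e g,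
    Lp.coeFn_add u₁ u₂, hu₁, hu₂, coeFn_translate (h • EuclideanSpace.single e (1 : ℝ)) f]
    with x h1 h2 h3 h4 h5 h6 h7 h8
  rw [h4, h5, Pi.add_apply, h6, h7, h8, h3, h1, h2, ManyBody.diffQuot]
  push_cast
  ring

/-- Multiplication by `U` is bounded in the discrete Sobolev norm, with a constant which depends
only on the difference quotients of `U`. -/
lemma multForm_mul_self_le {h M : ℝ} (J : Finset (Fin N)) :
    ∀ (U : Config d N → ℝ), HasDiffBound h J U M →
      ∀ f g : WaveFn d N, (∀ᵐ x, g x = (U x : ℂ) * f x) →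
        multForm (discreteWeight h J) g g ≤
          ((2 * d + 2 : ℝ) ^ J.card * M ^ 2) * multForm (discreteWeight h J) f f := by
  induction J using Finset.induction_on with
  | empty =>
    intro U hU f g hg
    rw [discreteWeight_empty, multForm_one, multForm_one, ← integral_const_mul]
    have hI (f : WaveFn d N) : Integrable fun x => inner ℝ (f x) (f x) :=
      L2.integrable_inner (𝕜 := ℝ) f f
    refine integral_mono_ae (hI g) ((hI f).const_mul _) ?_
    have h0 := hU.2 [] (by simp) (by simp)
    filter_upwards [hg, h0] with x h1 h2
    simp only [List.map_nil, iterDiffQuot] at h2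
    simp only [h1, real_inner_self_eq_norm_sq, norm_mul, mul_pow, Complex.norm_real,
      Finset.card_empty, pow_zero, one_mul, Real.norm_eq_abs]
    gcongr
  | insert i J hi ih =>
    intro U hU f g hg
    have hb := isBddWeight_discreteWeight (d := d) h J
    have hp (ξ : Config d N) : 0 ≤ discreteWeight h J ξ := (discreteWeight_pos h J ξ).le
    have hUJ := hU.mono (Finset.subset_insert i J)
    rw [multForm_discreteWeight_insert h hi, multForm_discreteWeight_insert h hi,
      Finset.card_insert_of_notMem hi]
    set C := (2 * d + 2 : ℝ) ^ J.card * M ^ 2 with hC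
    have hC0 : 0 ≤ C := by positivity
    have h1 := ih U hUJ f g hg
    set q := multForm (discreteWeight h J) f f with hq
    set S : Fin d → ℝ := fun a => multForm (discreteWeight h J) (waveDiff h (i, a) f)
      (waveDiff h (i, a) f) with hS
    have hf0 : 0 ≤ q := multForm_self_nonneg hp f
    have hS0 (a : Fin d) : 0 ≤ S a := multForm_self_nonneg hp (waveDiff h (i, a) f)
    have h2 (a : Fin d) : multForm (discreteWeight h J) (waveDiff h (i, a) g)
        (waveDiff h (i, a) g) ≤ 2 * (C * q) + 2 * (C * S a) := by
      have hD := hU.diffQuot hi a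
      obtain ⟨u₁, hu₁⟩ := exists_mul_waveFn hD.1 (hD.2 [] (by simp) (by simp))
        (translate (h • EuclideanSpace.single (i, a) (1 : ℝ)) f)
      obtain ⟨u₂, hu₂⟩ := exists_mul_waveFn hU.1 (hU.2 [] (by simp) (by simp)) (waveDiff h (i, a) f)
      rw [waveDiff_mul hg hu₁ hu₂]
      refine (multForm_add_self_le hb hp u₁ u₂).trans ?_
      have h3 := ih _ hD _ u₁ hu₁
      rw [multForm_translate] at h3
      have h4 := ih _ hUJ _ u₂ hu₂
      linarith
    have h3 : ∑ a, multForm (discreteWeight h J) (waveDiff h (i, a) g) (waveDiff h (i, a) g) ≤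
        d * (2 * (C * q)) + 2 * (C * ∑ a, S a) := by
      refine (Finset.sum_le_sum fun a _ => h2 a).trans (le_of_eq ?_)
      rw [Finset.sum_add_distrib, Finset.sum_const, Finset.card_univ, Fintype.card_fin,
        ← Finset.mul_sum, ← Finset.mul_sum, nsmul_eq_mul]
    have hT0 : 0 ≤ ∑ a, S a := Finset.sum_nonneg fun a _ => hS0 a
    have h4 : (2 * d + 2 : ℝ) ^ (J.card + 1) * M ^ 2 = (2 * d + 2) * C := by
      rw [hC, pow_succ]; ring
    rw [h4]
    generalize (∑ a, S a) = T at h3 hT0 ⊢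
    generalize (∑ a, multForm (discreteWeight h J) (waveDiff h (i, a) g) (waveDiff h (i, a) g)) =
      T' at h3 ⊢
    have h5 : 0 ≤ C * q := mul_nonneg hC0 hf0
    have h6 : 0 ≤ C * T * d := by positivity
    linarith

/-- All but one of the derivatives of the particles in `insert a B` fall on the product `U f`; the
remaining one, in the particle `a`, is kept on the other factor. -/
lemma abs_multForm_mul_insert_le {h M δ : ℝ} (hM : 0 < M) (hδ : 0 < δ) {a : Fin N}
    {B : Finset (Fin N)} (ha : a ∉ B) {U : Config d N → ℝ} (hU : HasDiffBound h B U M)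
    (f g : WaveFn d N) (hg : ∀ᵐ x, g x = (U x : ℂ) * f x) :
    |multForm (discreteWeight h (insert a B)) f g| ≤ (2 * d + 2 : ℝ) ^ B.card * M *
      (δ / 2 * multForm (fun ξ => discreteWeight h B ξ * discreteSymbol h a ξ ^ 2) f f +
        1 / (2 * δ) * multForm (discreteWeight h B) f f) := by
  have hp (ξ : Config d N) : 0 ≤ discreteWeight h B ξ := (discreteWeight_pos h B ξ).le
  set K := (2 * d + 2 : ℝ) ^ B.card * M with hK
  have hc1 : (1 : ℝ) ≤ (2 * d + 2 : ℝ) ^ B.card :=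
    one_le_pow₀ (by linarith [d.cast_nonneg (α := ℝ)])
  have hK0 : 0 < K := by positivity
  have h1 := multForm_mul_self_le B U hU f g hg
  have h2 : multForm (discreteWeight h B) g g ≤ K ^ 2 * multForm (discreteWeight h B) f f := by
    refine h1.trans (mul_le_mul_of_nonneg_right ?_ (multForm_self_nonneg hp f))
    rw [hK, mul_pow]
    gcongr
    nlinarith
  have h3 : (discreteWeight h (insert a B) : Config d N → ℝ) =
      fun ξ => discreteWeight h B ξ * discreteSymbol h a ξ := by
    funext ξ
    rw [discreteWeight, Finset.prod_insert ha, mul_comm]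
    rfl
  rw [h3]
  refine (abs_multForm_mul_le (isBddWeight_discreteWeight h B) (isBddWeight_discreteSymbol h a) hp
    (mul_pos hδ hK0) f g).trans ?_
  have h4 : 1 / (2 * (δ * K)) * multForm (discreteWeight h B) g g ≤
      1 / (2 * (δ * K)) * (K ^ 2 * multForm (discreteWeight h B) f f) := by gcongr
  refine (add_le_add_right h4 _).trans (le_of_eq ?_)
  field_simp

end Multiplication

/-! ### Difference quotients of the interaction potentials -/

section Potentials

lemma quasiMeasurePreserving_of_surjective {E F : Type*} [NormedAddCommGroup E]
    [InnerProductSpace ℝ E] [FiniteDimensional ℝ E] [MeasurableSpace E] [BorelSpace E]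
    [NormedAddCommGroup F] [InnerProductSpace ℝ F] [FiniteDimensional ℝ F] [MeasurableSpace F]
    [BorelSpace F] (L : E →ₗ[ℝ] F) (hL : Function.Surjective L) :
    Measure.QuasiMeasurePreserving L (volume : Measure E) (volume : Measure F) := by
  refine ⟨L.continuous_of_finiteDimensional.measurable, ?_⟩
  obtain ⟨c, -, hc⟩ := L.exists_map_addHaar_eq_smul_addHaar volume volume hL
  rw [hc]
  exact Measure.smul_absolutelyContinuous

lemma iterDiffQuot_comp_linearMap {E F : Type*} [NormedAddCommGroup E] [NormedSpace ℝ E]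
    [NormedAddCommGroup F] [NormedSpace ℝ F] (L : E →ₗ[ℝ] F) {h lam : ℝ} (hh : h ≠ 0)
    (hlam : lam ≠ 0) :
    ∀ (l : List E) (c : ℝ) (f : F → ℝ) (x : E),
      iterDiffQuot h l (fun x => c * f (lam • L x)) x =
        c * lam ^ l.length * iterDiffQuot (h * lam) (l.map L) f (lam • L x)
  | [], c, f, x => by simp [iterDiffQuot]
  | v :: l, c, f, x => by
    have h1 : diffQuot h v (fun x => c * f (lam • L x)) =
        fun x => (c * lam) * diffQuot (h * lam) (L v) f (lam • L x) := by
      funext x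
      simp only [diffQuot, map_add, map_smul, smul_add, smul_smul, mul_comm lam h]
      field_simp
    simp only [iterDiffQuot, List.map_cons, List.length_cons, h1]
    rw [iterDiffQuot_comp_linearMap L hh hlam l]
    ring

lemma iterDiffQuot_eq_zero_of_mem {E : Type*} [NormedAddCommGroup E] [NormedSpace ℝ E] (h : ℝ) :
    ∀ (l : List E) (f : E → ℝ), (0 : E) ∈ l → iterDiffQuot h l f = 0
  | v :: l, f, hl => by
    rcases List.mem_cons.1 hl with hv | hl
    · have : diffQuot h v f = 0 := by funext x; simp [diffQuot, ← hv]
      rw [iterDiffQuot, this, iterDiffQuot_zero]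
    · exact iterDiffQuot_eq_zero_of_mem h l _ hl

variable {d N p : ℕ}

/-- The linear map `x ↦ (x_{i_1} - x_{i_2}, …, x_{i_1} - x_{i_{p+1}})`. -/
def differencesₗ (i : Fin (p + 1) → Fin N) : Config d N →ₗ[ℝ] Config d p where
  toFun := differences i
  map_add' x y := by ext ja; simp [differences]; ring
  map_smul' c x := by ext ja; simp [differences]; ring

lemma differencesₗ_surjective {i : Fin (p + 1) → Fin N} (hi : Function.Injective i) :
    Function.Surjective (differencesₗ i : Config d N →ₗ[ℝ] Config d p) := by
  classical
  intro y
  refine ⟨WithLp.toLp 2 fun ba => ∑ j : Fin p, if i j.succ = ba.1 then -y (j, ba.2) else 0, ?_⟩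
  ext ⟨j, a⟩
  simp only [differencesₗ, LinearMap.coe_mk, AddHom.coe_mk, differences]
  have h1 (j' : Fin p) : i j'.succ ≠ i 0 := fun h => Fin.succ_ne_zero _ (hi h)
  have h2 (j' : Fin p) : i j'.succ = i j.succ ↔ j' = j :=
    ⟨fun h => Fin.succ_injective _ (hi h), fun h => by rw [h]⟩
  simp [h1, h2]

/-- The direction in `ℝ^{pd}` in which the differences move when the `a`-th coordinate of the
`m`-th of the `p + 1` particles moves. -/
def relativeDir (e : Fin (p + 1) × Fin d) : Config d p :=
  WithLp.toLp 2 fun ja => (if e = (0, ja.2) then 1 else 0) - if e = (ja.1.succ, ja.2) then 1 else 0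

lemma differencesₗ_single_of_mem {i : Fin (p + 1) → Fin N} (hi : Function.Injective i)
    (m : Fin (p + 1)) (a : Fin d) :
    differencesₗ i (EuclideanSpace.single (i m, a) (1 : ℝ)) = relativeDir (m, a) := by
  ext ja
  simp only [differencesₗ, LinearMap.coe_mk, AddHom.coe_mk, differences, relativeDir,
    PiLp.single_apply, Prod.mk.injEq, hi.eq_iff]
  congr 1 <;> simp only [eq_comm]

lemma differencesₗ_single_of_notMem {i : Fin (p + 1) → Fin N} {b : Fin N} (hb : ∀ m, i m ≠ b)
    (a : Fin d) :
    differencesₗ i (EuclideanSpace.single (b, a) (1 : ℝ)) = (0 : Config d p) := by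
  ext ja
  simp [differencesₗ, differences, hb]

/-- All iterated difference quotients of order at most `p` of `f`, along the directions that come
from moving particles, are bounded by `M`. -/
def RelativeDiffBound (f : Config d p → ℝ) (M : ℝ) : Prop :=
  ∀ l : List (Fin (p + 1) × Fin d), l.length ≤ p → ∀ h : ℝ, h ≠ 0 →
    ∀ᵐ y, |iterDiffQuot h (l.map relativeDir) f y| ≤ M

lemma MemSobolevInfty.exists_relativeDiffBound {f : Config d p → ℝ} (hf : MemSobolevInfty p f) :
    ∃ M, 0 < M ∧ RelativeDiffBound f M := by
  have h1 (l : List (Fin (p + 1) × Fin d)) : ∃ M : ℝ, l.length ≤ p → ∀ h : ℝ, h ≠ 0 →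
      ∀ᵐ y, |iterDiffQuot h (l.map relativeDir) f y| ≤ M := by
    by_cases hl : l.length ≤ p
    · have hl' : (l.map (relativeDir (d := d))).length ≤ p := by simpa using hl
      obtain ⟨g, hg, hfg⟩ := hf.2 _ hl' (l.map relativeDir).get
      exact ⟨_, fun _ h hh => ae_abs_iterDiffQuot_le hf.1 hg _ hfg hh⟩
    · exact ⟨0, fun h => absurd h hl⟩
  choose M hM using h1
  have hfin : {l : List (Fin (p + 1) × Fin d) | l.length ≤ p}.Finite := List.finite_length_le _ p
  obtain ⟨B, hB⟩ := (hfin.image M).bddAbove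
  refine ⟨max B 1, by positivity, fun l hl h hh => ?_⟩
  filter_upwards [hM l hl h hh] with y hy
  exact hy.trans ((hB ⟨l, hl, rfl⟩).trans (le_max_left _ _))

/-- Each of the at most `p` derivatives that hit the scaled potential costs a factor `N^β`. The
particle `i m` is left out, since `p + 1` derivatives of `V` are not available. -/
lemma hasDiffBound_scaledPotential {V : Config d p → ℝ} (hV : AEStronglyMeasurable V) {M : ℝ}
    (hM : RelativeDiffBound V M) (hM0 : 0 < M) (hN : 1 ≤ N) {β : ℝ} (hβ : 0 < β) {h : ℝ}
    (hh : h ≠ 0) {i : Fin (p + 1) → Fin N} (hi : Function.Injective i) (m : Fin (p + 1))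
    (J : Finset (Fin N)) :
    HasDiffBound h (J.erase (i m)) (fun x => scaledPotential N β V (differences i x))
      ((N : ℝ) ^ ((p : ℝ) * (d : ℝ) * β) * M *
        ∏ m' ∈ Finset.univ.erase m, if i m' ∈ J then (N : ℝ) ^ β else 1) := by
  have hN1 : (1 : ℝ) ≤ N := by exact_mod_cast hN
  have hN0 : (0 : ℝ) < N := by linarith
  set lam : ℝ := (N : ℝ) ^ β with hlam
  have hlam1 : 1 ≤ lam := Real.one_le_rpow hN1 hβ.le
  have hlam0 : lam ≠ 0 := by positivity
  set c : ℝ := (N : ℝ) ^ ((p : ℝ) * (d : ℝ) * β) with hc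
  have hc0 : 0 < c := by positivity
  have hq : Measure.QuasiMeasurePreserving (fun x : Config d N => lam • differencesₗ i x)
      volume (volume : Measure (Config d p)) := by
    have := quasiMeasurePreserving_of_surjective
      (lam • differencesₗ i : Config d N →ₗ[ℝ] Config d p)
      (fun y => by
        obtain ⟨x, hx⟩ := differencesₗ_surjective hi (lam⁻¹ • y)
        exact ⟨x, by rw [LinearMap.smul_apply, hx, smul_smul, mul_inv_cancel₀ hlam0, one_smul]⟩)
    exact this
  refine ⟨?_, fun l hnd hl => ?_⟩
  · exact (hV.comp_quasiMeasurePreserving hq).const_mul c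
  · have hprod : (0 : ℝ) < ∏ m' ∈ Finset.univ.erase m, if i m' ∈ J then lam else 1 :=
      Finset.prod_pos fun m' _ => by split_ifs <;> positivity
    have hcomp := iterDiffQuot_comp_linearMap (differencesₗ i : Config d N →ₗ[ℝ] Config d p)
      hh hlam0 (l.map fun e => EuclideanSpace.single e (1 : ℝ)) c V
    have hcomp' (x : Config d N) : iterDiffQuot h (l.map fun e => EuclideanSpace.single e (1 : ℝ))
        (fun x => scaledPotential N β V (differences i x)) x = _ := hcomp x
    simp only [hcomp', List.length_map, List.map_map]
    by_cases hr : ∀ e ∈ l, ∃ m', i m' = e.1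
    · -- the list `l` comes from a list of coordinates of the `p` particles other than `i m`
      choose! s hs using hr
      set l' : List (Fin (p + 1) × Fin d) := l.map fun e => (s e, e.2) with hl'
      have hmap : l.map (⇑(differencesₗ i : Config d N →ₗ[ℝ] Config d p) ∘
          fun e => EuclideanSpace.single e (1 : ℝ)) = l'.map relativeDir := by
        rw [hl', List.map_map]
        refine List.map_congr_left fun e he => ?_
        have := differencesₗ_single_of_mem hi (s e) e.2
        rw [hs e he] at this
        exact this
      have hsub : (l.map Prod.fst).toFinset ⊆
          ((Finset.univ.erase m).filter fun m' => i m' ∈ J).image i := by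
        intro b hb
        obtain ⟨e, he, rfl⟩ := List.mem_map.1 (List.mem_toFinset.1 hb)
        have hJ := Finset.mem_erase.1 (hl e he)
        rw [← hs e he] at hJ ⊢
        exact Finset.mem_image_of_mem i (Finset.mem_filter.2
          ⟨Finset.mem_erase.2 ⟨fun h => hJ.1 (by rw [h]), Finset.mem_univ _⟩, hJ.2⟩)
      have hlen : l.length ≤ ((Finset.univ.erase m).filter fun m' => i m' ∈ J).card := by
        have := (Finset.card_le_card hsub).trans Finset.card_image_le
        rwa [List.toFinset_card_of_nodup hnd, List.length_map] at this
      have hlenp : l'.length ≤ p := by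
        rw [hl', List.length_map]
        refine hlen.trans ((Finset.card_filter_le _ _).trans ?_)
        simp
      have hpow : lam ^ l.length ≤ ∏ m' ∈ Finset.univ.erase m, if i m' ∈ J then lam else 1 := by
        rw [Finset.prod_ite, Finset.prod_const, Finset.prod_const_one, mul_one]
        exact pow_le_pow_right₀ hlam1 hlen
      filter_upwards [hq.ae (hM l' hlenp (h * lam) (mul_ne_zero hh hlam0))] with x hx
      rw [hmap, abs_mul, abs_of_pos (by positivity : 0 < c * lam ^ l.length)]
      calc c * lam ^ l.length * _ ≤ c * (∏ m' ∈ Finset.univ.erase m, if i m' ∈ J then lam else 1) *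
            M := by gcongr
        _ = _ := by ring
    · push Not at hr
      obtain ⟨e, he, hne⟩ := hr
      refine Filter.Eventually.of_forall fun x => ?_
      rw [iterDiffQuot_eq_zero_of_mem]
      · simp only [Pi.zero_apply, mul_zero, abs_zero]
        positivity
      · exact List.mem_map.2 ⟨e, he, differencesₗ_single_of_notMem hne e.2⟩

end Potentials

/-! ### Counting index tuples that meet a set of particles -/

section Counting

variable {α : Type*} [Fintype α] [DecidableEq α]

/-- Pairs of a `k`-set and a point outside of it correspond to pairs of a `(k+1)`-set and a point
in it. -/
lemma sum_powersetCard_compl {R : Type*} [AddCommMonoid R] (k : ℕ) (g : Finset α → α → R) :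
    ∑ A ∈ Finset.univ.powersetCard k, ∑ j ∈ Aᶜ, g A j =
      ∑ J ∈ Finset.univ.powersetCard (k + 1), ∑ a ∈ J, g (J.erase a) a := by
  rw [Finset.sum_sigma', Finset.sum_sigma']
  refine Finset.sum_bij' (fun x _ => ⟨insert x.2 x.1, x.2⟩) (fun x _ => ⟨x.1.erase x.2, x.2⟩)
    ?_ ?_ ?_ ?_ ?_
  · rintro ⟨A, j⟩ h
    simp only [Finset.mem_sigma, Finset.mem_powersetCard_univ, Finset.mem_compl] at h ⊢
    exact ⟨by rw [Finset.card_insert_of_notMem h.2, h.1], Finset.mem_insert_self _ _⟩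
  · rintro ⟨J, a⟩ h
    simp only [Finset.mem_sigma, Finset.mem_powersetCard_univ, Finset.mem_compl] at h ⊢
    exact ⟨by rw [Finset.card_erase_of_mem h.2, h.1]; rfl, Finset.notMem_erase _ _⟩
  · rintro ⟨A, j⟩ h
    simp only [Finset.mem_sigma, Finset.mem_compl] at h
    simp [Finset.erase_insert h.2]
  · rintro ⟨J, a⟩ h
    simp only [Finset.mem_sigma] at h
    simp [Finset.insert_erase h.2]
  · rintro ⟨A, j⟩ h
    simp only [Finset.mem_sigma, Finset.mem_compl] at h
    simp [Finset.erase_insert h.2]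

lemma sum_powersetCard_insert {R : Type*} [AddCommMonoid R] (k : ℕ) (f : Finset α → R) :
    ∑ A ∈ Finset.univ.powersetCard k, ∑ j ∈ Aᶜ, f (insert j A) =
      (k + 1) • ∑ J ∈ Finset.univ.powersetCard (k + 1), f J := by
  rw [sum_powersetCard_compl k fun A j => f (insert j A), Finset.smul_sum]
  refine Finset.sum_congr rfl fun J hJ => ?_
  rw [Finset.sum_congr rfl fun a ha => by rw [Finset.insert_erase ha], Finset.sum_const,
    (Finset.mem_powersetCard.1 hJ).2]

end Counting

/-- Summing over all tuples with a distinguished entry `m`, where `F` is evaluated at that entry and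
`w` at all others. -/
lemma sum_tuples_eq {α : Type*} [Fintype α] {p : ℕ} (w F : α → ℝ) :
    ∑ i : Fin (p + 1) → α, ∑ m, F (i m) * ∏ m' ∈ Finset.univ.erase m, w (i m') =
      (p + 1) * ((∑ a, F a) * (∑ a, w a) ^ p) := by
  rw [Finset.sum_comm]
  have h (m : Fin (p + 1)) : ∑ i : Fin (p + 1) → α,
      F (i m) * ∏ m' ∈ Finset.univ.erase m, w (i m') = (∑ a, F a) * (∑ a, w a) ^ p := by
    have h1 (i : Fin (p + 1) → α) : F (i m) * ∏ m' ∈ Finset.univ.erase m, w (i m') =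
        ∏ m', (if m' = m then F else w) (i m') := by
      rw [← Finset.mul_prod_erase _ _ (Finset.mem_univ m), if_pos rfl]
      congr 1
      exact Finset.prod_congr rfl fun m' hm' => by rw [if_neg (Finset.ne_of_mem_erase hm')]
    simp only [h1]
    have h2 := Finset.prod_univ_sum (fun _ : Fin (p + 1) => (Finset.univ : Finset α))
      fun m' a => (if m' = m then F else w) a
    rw [Fintype.piFinset_univ] at h2
    rw [← h2, ← Finset.mul_prod_erase _ _ (Finset.mem_univ m), if_pos rfl]
    congr 1
    rw [Finset.prod_congr rfl fun m' hm' => by rw [if_neg (Finset.ne_of_mem_erase hm')],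
      Finset.prod_const, Finset.card_erase_of_mem (Finset.mem_univ m)]
    simp
  rw [Finset.sum_congr rfl fun m _ => h m]
  simp


/-! ### The interaction as a form perturbation -/

section Interaction

variable {d N : ℕ}

/-- The form which controls a potential acting on the particle `a`: the second discrete derivative
in `a` has the small weight `δ`. -/
def errorForm (h δ : ℝ) (f : WaveFn d N) (B : Finset (Fin N)) (a : Fin N) : ℝ :=
  δ / 2 * multForm (fun ξ => discreteWeight h B ξ * discreteSymbol h a ξ ^ 2) f f +
    1 / (2 * δ) * multForm (discreteWeight h B) f f

lemma errorForm_nonneg {h δ : ℝ} (hδ : 0 < δ) (f : WaveFn d N) (B : Finset (Fin N)) (a : Fin N) :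
    0 ≤ errorForm h δ f B a := by
  have h1 := multForm_self_nonneg (fun ξ => (discreteWeight_pos h B ξ).le) f
  have h2 := multForm_self_nonneg (fun ξ => mul_nonneg (discreteWeight_pos h B ξ).le
    (sq_nonneg (discreteSymbol h a ξ))) f
  unfold errorForm
  positivity

lemma scaledPotential_differences_nonneg {p : ℕ} {V : Config d p → ℝ} (hV : ∀ᵐ y, 0 ≤ V y)
    (hN : 1 ≤ N) (β : ℝ) {i : Fin (p + 1) → Fin N} (hi : Function.Injective i) :
    ∀ᵐ x : Config d N, 0 ≤ scaledPotential N β V (differences i x) := by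
  have hN0 : (0 : ℝ) < N := by exact_mod_cast hN
  have hlam : (N : ℝ) ^ β ≠ 0 := by positivity
  have hq := quasiMeasurePreserving_of_surjective
    ((N : ℝ) ^ β • differencesₗ i : Config d N →ₗ[ℝ] Config d p) (fun y => by
      obtain ⟨x, hx⟩ := differencesₗ_surjective hi (((N : ℝ) ^ β)⁻¹ • y)
      exact ⟨x, by rw [LinearMap.smul_apply, hx, smul_smul, mul_inv_cancel₀ hlam, one_smul]⟩)
  filter_upwards [hq.ae hV] with x hx
  exact mul_nonneg (by positivity) hx

/-- The potentials of one order `p`. A tuple which does not meet `J` contributes a non-negative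
term. A tuple with `q` particles in `J` costs `N^{(q-1)β} ≤ N^{q-1}`, and there are of order
`N^{p+1-q}` of them. -/
lemma neg_le_sum_multForm {p : ℕ} {V : Config d p → ℝ} (hVm : AEStronglyMeasurable V)
    (hVpos : ∀ᵐ y, 0 ≤ V y) {M : ℝ} (hM : RelativeDiffBound V M) (hM0 : 0 < M) (hN : 1 ≤ N)
    {β : ℝ} (hβ : 0 < β) (hβ1 : β ≤ 1) {h δ : ℝ} (hh : h ≠ 0) (hδ : 0 < δ) {k : ℕ}
    {J : Finset (Fin N)} (hJ : J.card = k + 1) (f : WaveFn d N)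
    (s : Finset (Fin (p + 1) → Fin N)) (hs : ∀ i ∈ s, Function.Injective i)
    (g : (Fin (p + 1) → Fin N) → WaveFn d N)
    (hg : ∀ i ∈ s, ∀ᵐ x, g i x = (scaledPotential N β V (differences i x) : ℂ) * f x) :
    -((2 * d + 2 : ℝ) ^ k * M * (p + 1) * (k + 2) ^ p * (N : ℝ) ^ ((p : ℝ) * (d : ℝ) * β) *
        (N : ℝ) ^ p * ∑ a ∈ J, errorForm h δ f (J.erase a) a) ≤
      ∑ i ∈ s, multForm (discreteWeight h J) f (g i) := by
  have hN1 : (1 : ℝ) ≤ N := by exact_mod_cast hN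
  have hN0 : (0 : ℝ) < N := by linarith
  set c : ℝ := (N : ℝ) ^ ((p : ℝ) * (d : ℝ) * β) with hc
  have hc0 : 0 < c := by positivity
  set κ : ℝ := (2 * d + 2 : ℝ) ^ k * (c * M) with hκ
  have hκ0 : 0 < κ := by positivity
  set G : Fin N → ℝ := fun a => if a ∈ J then errorForm h δ f (J.erase a) a else 0 with hG
  have hG0 (a : Fin N) : 0 ≤ G a := by
    simp only [hG]
    split_ifs
    · exact errorForm_nonneg hδ f _ a
    · exact le_rfl
  set w : Fin N → ℝ := fun b => if b ∈ J then (N : ℝ) ^ β else 1 with hw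
  have hw0 (b : Fin N) : 0 < w b := by simp only [hw]; split_ifs <;> positivity
  have hterm0 (i : Fin (p + 1) → Fin N) (m : Fin (p + 1)) :
      0 ≤ G (i m) * ∏ m' ∈ Finset.univ.erase m, w (i m') :=
    mul_nonneg (hG0 _) (Finset.prod_nonneg fun _ _ => (hw0 _).le)
  have hterm (i : Fin (p + 1) → Fin N) (hi : i ∈ s) :
      -(κ * ∑ m, G (i m) * ∏ m' ∈ Finset.univ.erase m, w (i m')) ≤
        multForm (discreteWeight h J) f (g i) := by
    by_cases hmeet : ∃ m, i m ∈ J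
    · obtain ⟨m, hm⟩ := hmeet
      have hb := hasDiffBound_scaledPotential hVm hM hM0 hN hβ hh (hs i hi) m J
      have hw1 : (0 : ℝ) < ∏ m' ∈ Finset.univ.erase m, w (i m') :=
        Finset.prod_pos fun _ _ => hw0 _
      have h1 := abs_multForm_mul_insert_le (mul_pos (mul_pos hc0 hM0) hw1) hδ
        (Finset.notMem_erase (i m) J) hb f (g i) (hg i hi)
      rw [Finset.insert_erase hm, Finset.card_erase_of_mem hm, hJ, Nat.add_sub_cancel] at h1
      have h2 : κ * (G (i m) * ∏ m' ∈ Finset.univ.erase m, w (i m')) ≤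
          κ * ∑ m, G (i m) * ∏ m' ∈ Finset.univ.erase m, w (i m') :=
        mul_le_mul_of_nonneg_left
          (Finset.single_le_sum (fun m _ => hterm0 i m) (Finset.mem_univ m)) hκ0.le
      have h3 : G (i m) = errorForm h δ f (J.erase (i m)) (i m) := if_pos hm
      have h4 := (abs_le.1 h1).1
      rw [h3] at h2
      unfold errorForm at h2
      refine le_trans (neg_le_neg (le_trans (le_of_eq ?_) h2)) h4
      ring
    · push Not at hmeet
      have h1 : ∑ m, G (i m) * ∏ m' ∈ Finset.univ.erase m, w (i m') = 0 :=
        Finset.sum_eq_zero fun m _ => by simp [hG, hmeet m]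
      rw [h1, mul_zero, neg_zero]
      refine multForm_mul_nonneg (scaledPotential_differences_nonneg hVpos hN β (hs i hi)) J
        (fun b hb a x => ?_) f (g i) (hg i hi)
      have h2 : differencesₗ i (EuclideanSpace.single (b, a) (1 : ℝ)) = (0 : Config d p) :=
        differencesₗ_single_of_notMem (fun m hm => hmeet m (by rw [hm]; exact hb)) a
      have h3 : differences i (x + h • EuclideanSpace.single (b, a) (1 : ℝ)) = differences i x := by
        have := (differencesₗ i : Config d N →ₗ[ℝ] Config d p).map_add x
          (h • EuclideanSpace.single (b, a) (1 : ℝ))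
        rw [map_smul, h2, smul_zero, add_zero] at this
        exact this
      rw [h3]
  have hsumw : ∑ b, w b ≤ (k + 2) * N := by
    have h1 (b : Fin N) : w b ≤ (if b ∈ J then (N : ℝ) else 0) + 1 := by
      simp only [hw]
      split_ifs
      · have := Real.rpow_le_rpow_of_exponent_le hN1 hβ1
        rw [Real.rpow_one] at this
        linarith
      · simp
    refine (Finset.sum_le_sum fun b _ => h1 b).trans (le_of_eq ?_)
    rw [Finset.sum_add_distrib, Finset.sum_ite_mem, Finset.univ_inter, Finset.sum_const,
      Finset.sum_const, hJ, Finset.card_univ, Fintype.card_fin]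
    simp only [nsmul_eq_mul]
    push_cast
    ring
  have hsumG : ∑ a, G a = ∑ a ∈ J, errorForm h δ f (J.erase a) a := by
    simp only [hG, Finset.sum_ite_mem, Finset.univ_inter]
  refine le_trans ?_ (Finset.sum_le_sum hterm)
  rw [Finset.sum_neg_distrib, ← Finset.mul_sum]
  refine neg_le_neg ?_
  calc κ * ∑ i ∈ s, ∑ m, G (i m) * ∏ m' ∈ Finset.univ.erase m, w (i m')
      ≤ κ * ∑ i : Fin (p + 1) → Fin N, ∑ m, G (i m) * ∏ m' ∈ Finset.univ.erase m, w (i m') := by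
        refine mul_le_mul_of_nonneg_left ?_ hκ0.le
        exact Finset.sum_le_univ_sum_of_nonneg fun i => Finset.sum_nonneg fun m _ => hterm0 i m
    _ = κ * ((p + 1) * ((∑ a, G a) * (∑ b, w b) ^ p)) := by rw [sum_tuples_eq]
    _ ≤ κ * ((p + 1) * ((∑ a, G a) * ((k + 2) * N) ^ p)) := by
        have h1 : 0 ≤ ∑ a, G a := Finset.sum_nonneg fun a _ => hG0 a
        have h2 : 0 ≤ ∑ b, w b := Finset.sum_nonneg fun b _ => (hw0 b).le
        gcongr
    _ = _ := by rw [hsumG, hκ, mul_pow]; ring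

/-- The relative size of the interaction, up to the gain of `N^{-1/2}`. -/
def interactionBound (d N p₀ k : ℕ) (β : ℝ) (M : ℕ → ℝ) : ℝ :=
  ∑ p ∈ Finset.Icc 1 p₀, (2 * d + 2 : ℝ) ^ k * M p * (p + 1) * (k + 2) ^ p *
    (N : ℝ) ^ ((p : ℝ) * (d : ℝ) * β)

/-- The whole interaction is bounded below by the forms which control a single particle. -/
lemma neg_le_multForm_interaction {p₀ : ℕ} {V : (p : ℕ) → Config d p → ℝ}
    (hVm : ∀ p ∈ Finset.Icc 1 p₀, AEStronglyMeasurable (V p))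
    (hVpos : ∀ p ∈ Finset.Icc 1 p₀, ∀ᵐ y, 0 ≤ V p y) {M : ℕ → ℝ}
    (hM : ∀ p ∈ Finset.Icc 1 p₀, RelativeDiffBound (V p) (M p))
    (hM0 : ∀ p ∈ Finset.Icc 1 p₀, 0 < M p) (hN : 1 ≤ N)
    {β : ℝ} (hβ : 0 < β) (hβ1 : β ≤ 1) {h δ : ℝ} (hh : h ≠ 0) (hδ : 0 < δ) {k : ℕ}
    {J : Finset (Fin N)} (hJ : J.card = k + 1) (f w : WaveFn d N)
    (hw : ∀ᵐ x, w x = (interaction d N p₀ β V x : ℂ) * f x) :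
    -(interactionBound d N p₀ k β M * ∑ a ∈ J, errorForm h δ f (J.erase a) a) ≤
      multForm (discreteWeight h J) f w := by
  classical
  have hN0 : (0 : ℝ) < N := by exact_mod_cast hN
  have hex (p : ℕ) (i : Fin (p + 1) → Fin N) : ∃ g : WaveFn d N, p ∈ Finset.Icc 1 p₀ →
      StrictMono i → ∀ᵐ x, g x = (scaledPotential N β (V p) (differences i x) : ℂ) * f x := by
    by_cases hp : p ∈ Finset.Icc 1 p₀ ∧ StrictMono i
    · have hb := hasDiffBound_scaledPotential (hVm p hp.1) (hM p hp.1) (hM0 p hp.1) hN hβ hh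
        hp.2.injective 0 J
      obtain ⟨g, hg⟩ := exists_mul_waveFn hb.1 (hb.2 [] (by simp) (by simp)) f
      exact ⟨g, fun _ _ => hg⟩
    · exact ⟨0, fun h1 h2 => absurd ⟨h1, h2⟩ hp⟩
  choose g hg using hex
  have hwsum : w = ∑ p ∈ Finset.Icc 1 p₀, ((((N : ℝ) ^ p)⁻¹ : ℝ) : ℂ) •
      ∑ i : Fin (p + 1) → Fin N with StrictMono i, g p i := by
    refine Lp.ext ?_
    have h1 : ∀ᵐ x : Config d N, ∀ p ∈ Finset.Icc 1 p₀, ∀ i : Fin (p + 1) → Fin N, StrictMono i →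
        g p i x = (scaledPotential N β (V p) (differences i x) : ℂ) * f x :=
      (ae_ball_iff (Finset.Icc 1 p₀).countable_toSet).2 fun p hp => ae_all_iff.2 fun i => by
        by_cases hi : StrictMono i
        · filter_upwards [hg p i hp hi] with x hx _ using hx
        · exact Filter.Eventually.of_forall fun x h => absurd h hi
    have h2 : ∀ᵐ x : Config d N, ∀ p, (((((N : ℝ) ^ p)⁻¹ : ℝ) : ℂ) •
        ∑ i : Fin (p + 1) → Fin N with StrictMono i, g p i : WaveFn d N) x =
          ((((N : ℝ) ^ p)⁻¹ : ℝ) : ℂ) * ∑ i : Fin (p + 1) → Fin N with StrictMono i, g p i x :=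
      ae_all_iff.2 fun p => by
        filter_upwards [Lp.coeFn_smul ((((N : ℝ) ^ p)⁻¹ : ℝ) : ℂ)
          (∑ i : Fin (p + 1) → Fin N with StrictMono i, g p i), Lp.coeFn_fun_finsetSum
            (Finset.univ.filter fun i : Fin (p + 1) → Fin N => StrictMono i) (g p)] with x h3 h4
        rw [h3, Pi.smul_apply, h4, smul_eq_mul]
    filter_upwards [hw, h1, h2, Lp.coeFn_fun_finsetSum (Finset.Icc 1 p₀) fun p =>
      ((((N : ℝ) ^ p)⁻¹ : ℝ) : ℂ) • ∑ i : Fin (p + 1) → Fin N with StrictMono i, g p i]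
      with x h3 h4 h5 h6
    rw [h3, h6, interaction, Complex.ofReal_sum, Finset.sum_mul]
    refine Finset.sum_congr rfl fun p hp => ?_
    rw [h5, Complex.ofReal_mul, mul_assoc, Complex.ofReal_sum, Finset.sum_mul]
    congr 1
    refine Finset.sum_congr (by congr) fun i hi => ?_
    rw [h4 p hp i (Finset.mem_filter.1 hi).2]
  have hb := isBddWeight_discreteWeight (d := d) h J
  rw [hwsum, multForm_sum_right _ hb, interactionBound, Finset.sum_mul, ← Finset.sum_neg_distrib]
  refine Finset.sum_le_sum fun p hp => ?_
  rw [multForm_smul_right, multForm_sum_right _ hb]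
  have h1 := neg_le_sum_multForm (hVm p hp) (hVpos p hp) (hM p hp) (hM0 p hp) hN hβ hβ1 hh hδ hJ f
    (Finset.univ.filter fun i : Fin (p + 1) → Fin N => StrictMono i)
    (fun i hi => (Finset.mem_filter.1 hi).2.injective) (g p)
    (fun i hi => hg p i hp (Finset.mem_filter.1 hi).2)
  have h2 : (0 : ℝ) < ((N : ℝ) ^ p)⁻¹ := by positivity
  refine le_trans (le_of_eq ?_) (mul_le_mul_of_nonneg_left h1 h2.le)
  field_simp

end Interaction

/-! ### The energy estimate with discrete derivatives -/

section DiscreteEnergy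

variable {d N : ℕ}

/-- The symbol of `∑_{j ∉ A} (1 - Δ_{x_j})`, with discrete Laplacians. -/
def discreteKinetic (h : ℝ) (A : Finset (Fin N)) (ξ : Config d N) : ℝ :=
  ∑ j ∈ Aᶜ, discreteSymbol h j ξ

lemma isBddWeight_discreteKinetic (h : ℝ) (A : Finset (Fin N)) :
    IsBddWeight (discreteKinetic h A : Config d N → ℝ) :=
  IsBddWeight.sum _ fun j => isBddWeight_discreteSymbol h j

lemma discreteKinetic_nonneg (h : ℝ) (A : Finset (Fin N)) (ξ : Config d N) :
    0 ≤ discreteKinetic h A ξ :=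
  Finset.sum_nonneg fun j _ => zero_le_one.trans (one_le_discreteSymbol h j ξ)

lemma sub_le_discreteKinetic (h : ℝ) (A : Finset (Fin N)) (ξ : Config d N) :
    (N : ℝ) - A.card ≤ discreteKinetic h A ξ := by
  have h1 := Finset.sum_le_sum fun j (_ : j ∈ Aᶜ) => one_le_discreteSymbol h j ξ
  rw [Finset.sum_const, nsmul_eq_mul, mul_one, Finset.card_compl, Fintype.card_fin,
    Nat.cast_sub (by simpa using Finset.card_le_univ A)] at h1
  exact h1

lemma discreteKinetic_le (h : ℝ) (A : Finset (Fin N)) (ξ : Config d N) :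
    discreteKinetic h A ξ ≤ ∑ j, (1 + laplaceSymbol ξ j) :=
  (Finset.sum_le_sum fun j _ => discreteSymbol_le h j ξ).trans
    (Finset.sum_le_univ_sum_of_nonneg fun j => by unfold laplaceSymbol; positivity)

/-- The form of `∏_{i ∈ A} (1 - Δ_{x_i}) (∑_{j ∉ A} (1 - Δ_{x_j}))²`, with discrete Laplacians. -/
def energyForm (h : ℝ) (A : Finset (Fin N)) (f : WaveFn d N) : ℝ :=
  multForm (fun ξ => discreteWeight h A ξ * discreteKinetic h A ξ ^ 2) f f

lemma energyForm_nonneg (h : ℝ) (A : Finset (Fin N)) (f : WaveFn d N) : 0 ≤ energyForm h A f :=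
  multForm_self_nonneg (fun ξ => mul_nonneg (discreteWeight_pos h A ξ).le (sq_nonneg _)) f

/-- Testing `φ = (H + N) ψ` with `∏_{i ∈ A} (1 - Δ_{x_i}) ∑_{j ∉ A} (1 - Δ_{x_j}) ψ`. -/
lemma energyForm_add_le {ψ φ w : WaveFn d N}
    (hφ : ∀ᵐ ξ : Config d N, 𝓕 φ ξ = ((∑ i, (1 + laplaceSymbol ξ i) : ℝ) : ℂ) * 𝓕 ψ ξ + 𝓕 w ξ)
    (h : ℝ) (A : Finset (Fin N)) :
    energyForm h A ψ + ∑ j ∈ Aᶜ, multForm (discreteWeight h (insert j A)) ψ w ≤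
      1 / 4 * energyForm h A ψ + multForm (discreteWeight h A) φ φ := by
  have hW := isBddWeight_discreteWeight (d := d) h A
  have hK := isBddWeight_discreteKinetic (d := d) h A
  have hWpos (ξ : Config d N) : 0 ≤ discreteWeight h A ξ := (discreteWeight_pos h A ξ).le
  have h1 : ∑ j ∈ Aᶜ, multForm (discreteWeight h (insert j A)) ψ w =
      multForm (fun ξ => discreteWeight h A ξ * discreteKinetic h A ξ) ψ w := by
    simp only [discreteKinetic, Finset.mul_sum]
    rw [multForm_sum_weight _ fun j => hW.mul (isBddWeight_discreteSymbol h j)]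
    refine Finset.sum_congr rfl fun j hj => ?_
    congr 1
    funext ξ
    rw [discreteWeight, Finset.prod_insert (Finset.mem_compl.1 hj), mul_comm]
    rfl
  have h2 : energyForm h A ψ + multForm (fun ξ => discreteWeight h A ξ * discreteKinetic h A ξ) ψ w
      ≤ multForm (fun ξ => discreteWeight h A ξ * discreteKinetic h A ξ) ψ φ := by
    unfold energyForm multForm
    have hI₁ := integrable_weight_inner (hW.mul hK.sq) (𝓕 ψ) (𝓕 ψ)
    have hI₂ := integrable_weight_inner (hW.mul hK) (𝓕 ψ) (𝓕 w)
    rw [← integral_add hI₁ hI₂]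
    refine integral_mono_ae (hI₁.add hI₂) (integrable_weight_inner (hW.mul hK) (𝓕 ψ) (𝓕 φ)) ?_
    filter_upwards [hφ] with ξ h3
    rw [h3, inner_add_right, ← Complex.real_smul, real_inner_smul_right]
    have h4 : discreteWeight h A ξ * discreteKinetic h A ξ * (discreteKinetic h A ξ *
        inner ℝ ((𝓕 ψ : WaveFn d N) ξ) ((𝓕 ψ : WaveFn d N) ξ)) ≤
        discreteWeight h A ξ * discreteKinetic h A ξ * ((∑ i, (1 + laplaceSymbol ξ i)) *
        inner ℝ ((𝓕 ψ : WaveFn d N) ξ) ((𝓕 ψ : WaveFn d N) ξ)) :=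
      mul_le_mul_of_nonneg_left
        (mul_le_mul_of_nonneg_right (discreteKinetic_le h A ξ) real_inner_self_nonneg)
        (mul_nonneg (hWpos ξ) (discreteKinetic_nonneg h A ξ))
    linarith
  have h3 := (abs_le.1 (abs_multForm_mul_le hW hK hWpos (ε := 1 / 2) (by norm_num) ψ φ)).2
  rw [h1]
  refine h2.trans (h3.trans (le_of_eq ?_))
  unfold energyForm
  norm_num

/-- The errors are controlled by the energy: `∑_{j ∉ A} s_j² ≤ (∑_{j ∉ A} s_j)²` for the second
derivatives, and `∑_{j ∉ A} s_j ≥ N - |A|` for the form without additional derivatives. -/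
lemma sum_errorForm_le {h δ : ℝ} (hδ : 0 < δ) {A : Finset (Fin N)} (hA : A.card < N)
    (f : WaveFn d N) :
    ∑ j ∈ Aᶜ, errorForm h δ f A j ≤
      (δ / 2 + N / (2 * δ * ((N : ℝ) - A.card) ^ 2)) * energyForm h A f := by
  have hW := isBddWeight_discreteWeight (d := d) h A
  have hK := isBddWeight_discreteKinetic (d := d) h A
  have hWpos (ξ : Config d N) : 0 ≤ discreteWeight h A ξ := (discreteWeight_pos h A ξ).le
  have hr : (0 : ℝ) < (N : ℝ) - A.card := sub_pos.2 (by exact_mod_cast hA)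
  have h1 : ∑ j ∈ Aᶜ, multForm (fun ξ => discreteWeight h A ξ * discreteSymbol h j ξ ^ 2) f f ≤
      energyForm h A f := by
    have hb (j : Fin N) := hW.mul (isBddWeight_discreteSymbol (d := d) h j).sq
    rw [← multForm_sum_weight _ hb]
    refine multForm_self_mono (IsBddWeight.sum _ hb) (hW.mul hK.sq) (fun ξ => ?_) f
    rw [← Finset.mul_sum]
    exact mul_le_mul_of_nonneg_left (Finset.sum_sq_le_sq_sum_of_nonneg fun j _ =>
      zero_le_one.trans (one_le_discreteSymbol h j ξ)) (hWpos ξ)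
  have h2 : ((N : ℝ) - A.card) ^ 2 * multForm (discreteWeight h A) f f ≤ energyForm h A f := by
    rw [← multForm_const_mul_weight]
    refine multForm_self_mono ((IsBddWeight.const _).mul hW) (hW.mul hK.sq) (fun ξ => ?_) f
    rw [mul_comm]
    exact mul_le_mul_of_nonneg_left (pow_le_pow_left₀ hr.le (sub_le_discreteKinetic h A ξ) 2)
      (hWpos ξ)
  have h3 : multForm (discreteWeight h A) f f ≤ energyForm h A f / ((N : ℝ) - A.card) ^ 2 := by
    rw [le_div_iff₀ (by positivity), mul_comm]
    exact h2
  have h4 : ((Aᶜ : Finset (Fin N)).card : ℝ) ≤ N := by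
    have := Finset.card_le_univ (Aᶜ : Finset (Fin N))
    rw [Fintype.card_fin] at this
    exact_mod_cast this
  have hX := multForm_self_nonneg hWpos f
  unfold errorForm
  rw [Finset.sum_add_distrib, ← Finset.mul_sum, Finset.sum_const, nsmul_eq_mul]
  calc _ ≤ δ / 2 * energyForm h A f +
        N * (1 / (2 * δ) * (energyForm h A f / ((N : ℝ) - A.card) ^ 2)) := by
        gcongr
    _ = _ := by field_simp

/-- One step `k → k + 2`, with discrete derivatives. The smallness condition holds for large `N`
because `p₀ d β < 1/2`. -/
lemma sum_energyForm_le {p₀ : ℕ} {V : (p : ℕ) → Config d p → ℝ}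
    (hVm : ∀ p ∈ Finset.Icc 1 p₀, AEStronglyMeasurable (V p))
    (hVpos : ∀ p ∈ Finset.Icc 1 p₀, ∀ᵐ y, 0 ≤ V p y) {M : ℕ → ℝ}
    (hM : ∀ p ∈ Finset.Icc 1 p₀, RelativeDiffBound (V p) (M p))
    (hM0 : ∀ p ∈ Finset.Icc 1 p₀, 0 < M p) (hN : 1 ≤ N)
    {β : ℝ} (hβ : 0 < β) (hβ1 : β ≤ 1) {h : ℝ} (hh : h ≠ 0) {k : ℕ} (hk : 2 * k ≤ N)
    (hsmall : interactionBound d N p₀ k β M * (k + 1) * (5 / 2) * (√N)⁻¹ ≤ 1 / 4)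
    {ψ φ w : WaveFn d N}
    (hφ : ∀ᵐ ξ : Config d N, 𝓕 φ ξ = ((∑ i, (1 + laplaceSymbol ξ i) : ℝ) : ℂ) * 𝓕 ψ ξ + 𝓕 w ξ)
    (hw : ∀ᵐ x, w x = (interaction d N p₀ β V x : ℂ) * ψ x) :
    ∑ A ∈ Finset.univ.powersetCard k, energyForm h A ψ ≤
      2 * ∑ A ∈ Finset.univ.powersetCard k, multForm (discreteWeight h A) φ φ := by
  have hN0 : (0 : ℝ) < N := by exact_mod_cast hN
  -- the weight `δ = N^{-1/2}` balances the two terms of `sum_errorForm_le`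
  set r : ℝ := √N with hr
  have hr0 : 0 < r := Real.sqrt_pos.2 hN0
  have hrr : r ^ 2 = N := Real.sq_sqrt hN0.le
  have hk' : (2 : ℝ) * k ≤ N := by exact_mod_cast hk
  set Λ := interactionBound d N p₀ k β M with hΛ
  have hΛ0 : 0 ≤ Λ := Finset.sum_nonneg fun p hp => by
    have := (hM0 p hp).le
    positivity
  have h1 := Finset.sum_le_sum fun A (_ : A ∈ Finset.univ.powersetCard k) =>
    energyForm_add_le hφ h A
  rw [Finset.sum_add_distrib, Finset.sum_add_distrib, ← Finset.mul_sum] at h1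
  have h2 : -(Λ * ((k + 1) * ∑ A ∈ (Finset.univ : Finset (Fin N)).powersetCard k,
      ∑ j ∈ Aᶜ, errorForm h r⁻¹ ψ A j)) ≤
      ∑ A ∈ Finset.univ.powersetCard k, ∑ j ∈ Aᶜ, multForm (discreteWeight h (insert j A)) ψ w := by
    rw [sum_powersetCard_insert k fun J => multForm (discreteWeight h J) ψ w,
      sum_powersetCard_compl k fun A j => errorForm h r⁻¹ ψ A j, nsmul_eq_mul]
    have h3 := Finset.sum_le_sum fun J (hJ : J ∈ Finset.univ.powersetCard (k + 1)) =>
      neg_le_multForm_interaction hVm hVpos hM hM0 hN hβ hβ1 hh (inv_pos.2 hr0)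
        (Finset.mem_powersetCard.1 hJ).2 ψ w hw
    rw [Finset.sum_neg_distrib, ← Finset.mul_sum] at h3
    have h4 := mul_le_mul_of_nonneg_left h3 (by positivity : (0 : ℝ) ≤ ((k + 1 : ℕ) : ℝ))
    push_cast at h4 ⊢
    linarith
  have h3 : ∑ A ∈ (Finset.univ : Finset (Fin N)).powersetCard k,
      ∑ j ∈ Aᶜ, errorForm h r⁻¹ ψ A j ≤
      (5 / 2 * r⁻¹) * ∑ A ∈ Finset.univ.powersetCard k, energyForm h A ψ := by
    rw [Finset.mul_sum]
    refine Finset.sum_le_sum fun A hA => ?_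
    have hAk := (Finset.mem_powersetCard.1 hA).2
    refine (sum_errorForm_le (inv_pos.2 hr0) (by omega) ψ).trans
      (mul_le_mul_of_nonneg_right ?_ (energyForm_nonneg h A ψ))
    rw [hAk]
    have h4 : (N : ℝ) / 2 ≤ N - k := by linarith
    have h5 : (N : ℝ) / (2 * r⁻¹ * ((N : ℝ) - k) ^ 2) ≤ N / (2 * r⁻¹ * (N / 2) ^ 2) := by
      gcongr
    have h6 : (N : ℝ) / (2 * r⁻¹ * (N / 2) ^ 2) = 2 * r⁻¹ := by
      rw [← hrr]
      field_simp
    rw [h6] at h5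
    linarith
  have hT : 0 ≤ ∑ A ∈ Finset.univ.powersetCard k, energyForm h A ψ :=
    Finset.sum_nonneg fun A _ => energyForm_nonneg h A ψ
  generalize (∑ A ∈ Finset.univ.powersetCard k, energyForm h A ψ) = T at h1 h3 hT ⊢
  have h4 := mul_le_mul_of_nonneg_left h3 (by positivity : 0 ≤ Λ * ((k : ℝ) + 1))
  have h5 := mul_le_mul_of_nonneg_right hsmall hT
  linarith

end DiscreteEnergy

/-! ### Removing the discretization -/

section Limit

variable {d N : ℕ}

/-- The form `∑_{|A| = k} ⟨f, ∏_{i ∈ A} (1 - Δ_{x_i}) f⟩`, over all sets of `k` particles. -/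
def sobolevSum (k : ℕ) (f : WaveFn d N) : ℝ≥0∞ :=
  ∫⁻ ξ, ENNReal.ofReal (∑ A ∈ Finset.univ.powersetCard k, ∏ i ∈ A, (1 + laplaceSymbol ξ i)) *
    ‖𝓕 f ξ‖ₑ ^ 2

lemma laplaceSymbol_nonneg (ξ : Config d N) (i : Fin N) : 0 ≤ laplaceSymbol ξ i := by
  unfold laplaceSymbol; positivity

lemma measurable_laplaceSymbol (i : Fin N) :
    Measurable fun ξ : Config d N => laplaceSymbol ξ i := by
  unfold laplaceSymbol particle
  simp only [mul_pow, EuclideanSpace.norm_sq_eq]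
  have : Continuous fun ξ : Config d N => (2 * Real.pi) ^ 2 * ∑ a, ‖ξ (i, a)‖ ^ 2 := by fun_prop
  simpa only [mul_pow] using this.measurable

lemma ofReal_multForm_self {m : Config d N → ℝ} (hm : IsBddWeight m) (hpos : ∀ ξ, 0 ≤ m ξ)
    (f : WaveFn d N) :
    ENNReal.ofReal (multForm m f f) = ∫⁻ ξ, ENNReal.ofReal (m ξ) * ‖𝓕 f ξ‖ₑ ^ 2 := by
  unfold multForm
  rw [ofReal_integral_eq_lintegral_ofReal (integrable_weight_inner hm _ _)
    (Filter.Eventually.of_forall fun ξ => mul_nonneg (hpos ξ) real_inner_self_nonneg)]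
  refine lintegral_congr fun ξ => ?_
  rw [ENNReal.ofReal_mul (hpos ξ), real_inner_self_eq_norm_sq, ENNReal.ofReal_pow (norm_nonneg _),
    ofReal_norm]

/-- Dropping the coincident indices: on the right, `(∑_{j ∉ A} s_j)²` contains `s_j s_l` for every
ordered pair `j ≠ l` outside of `A`, and each `(k + 2)`-set arises in this way from
`(k + 1)(k + 2)` choices of such a pair. -/
lemma esymm_le_sum_mul_sq (k : ℕ) (s : Fin N → ℝ) (hs : ∀ i, 0 ≤ s i) :
    ((k + 1) * (k + 2) : ℝ) * ∑ J ∈ Finset.univ.powersetCard (k + 2), ∏ i ∈ J, s i ≤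
      ∑ A ∈ Finset.univ.powersetCard k, (∏ i ∈ A, s i) * (∑ j ∈ Aᶜ, s j) ^ 2 := by
  have hstep (n : ℕ) : ((n : ℝ) + 1) * ∑ J ∈ Finset.univ.powersetCard (n + 1), ∏ i ∈ J, s i =
      ∑ A ∈ Finset.univ.powersetCard n, (∏ i ∈ A, s i) * ∑ j ∈ Aᶜ, s j := by
    have h1 := sum_powersetCard_insert n fun J : Finset (Fin N) => ∏ i ∈ J, s i
    rw [nsmul_eq_mul] at h1
    push_cast at h1
    rw [← h1]
    refine Finset.sum_congr rfl fun A _ => ?_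
    rw [Finset.mul_sum]
    refine Finset.sum_congr rfl fun j hj => ?_
    rw [Finset.prod_insert (Finset.mem_compl.1 hj), mul_comm]
  have h2 := hstep (k + 1)
  have h3 := sum_powersetCard_insert k fun J : Finset (Fin N) => (∏ i ∈ J, s i) * ∑ j ∈ Jᶜ, s j
  rw [nsmul_eq_mul] at h3
  push_cast at h2 h3
  calc ((k + 1) * (k + 2) : ℝ) * ∑ J ∈ Finset.univ.powersetCard (k + 2), ∏ i ∈ J, s i
      = ((k : ℝ) + 1) * (((k : ℝ) + 1 + 1) *
          ∑ J ∈ Finset.univ.powersetCard (k + 1 + 1), ∏ i ∈ J, s i) := by ring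
    _ ≤ _ := by
      rw [h2, ← h3]
      refine Finset.sum_le_sum fun A _ => ?_
      rw [pow_two, Finset.sum_mul, Finset.mul_sum]
      refine Finset.sum_le_sum fun j hj => ?_
      rw [Finset.prod_insert (Finset.mem_compl.1 hj), mul_comm (s j), mul_assoc]
      refine mul_le_mul_of_nonneg_left (mul_le_mul_of_nonneg_left ?_ (hs j))
        (Finset.prod_nonneg fun i _ => hs i)
      exact Finset.sum_le_sum_of_subset_of_nonneg
        (Finset.compl_subset_compl.2 (Finset.subset_insert j A)) fun i _ _ => hs i

/-- Fatou's lemma as the step of the discretization tends to `0`. In particular `sobolevSum` of `ψ`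
is finite when the one of `φ` is, so no regularity of `ψ` has to be known in advance. -/
lemma mul_sobolevSum_le_of_discrete {k : ℕ} {ψ φ : WaveFn d N}
    (hle : ∀ h : ℝ, h ≠ 0 → ∑ A ∈ Finset.univ.powersetCard k, energyForm h A ψ ≤
      2 * ∑ A ∈ Finset.univ.powersetCard k, multForm (discreteWeight h A) φ φ) :
    (((k + 1) * (k + 2) : ℕ) : ℝ≥0∞) * sobolevSum (k + 2) ψ ≤ 2 * sobolevSum k φ := by
  set P := (Finset.univ : Finset (Fin N)).powersetCard k with hP
  let s : ℕ → ℝ := fun n => 1 / ((n : ℝ) + 1)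
  have hs0 (n : ℕ) : s n ≠ 0 := by simp only [s]; positivity
  have hs : Filter.Tendsto s Filter.atTop (nhdsWithin 0 {0}ᶜ) :=
    tendsto_nhdsWithin_iff.2 ⟨tendsto_one_div_add_atTop_nhds_zero_nat,
      Filter.Eventually.of_forall hs0⟩
  let m : ℝ → Config d N → ℝ := fun h ξ =>
    ∑ A ∈ P, discreteWeight h A ξ * discreteKinetic h A ξ ^ 2
  have hbE (h : ℝ) (A : Finset (Fin N)) := (isBddWeight_discreteWeight (d := d) h A).mul
    (isBddWeight_discreteKinetic h A).sq
  have hm (h : ℝ) : IsBddWeight (m h) := IsBddWeight.sum _ (hbE h)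
  have hm0 (h : ℝ) (ξ : Config d N) : 0 ≤ m h ξ := Finset.sum_nonneg fun A _ =>
    mul_nonneg (discreteWeight_pos h A ξ).le (sq_nonneg _)
  have hbound (n : ℕ) : ∫⁻ ξ, ENNReal.ofReal (m (s n) ξ) * ‖𝓕 ψ ξ‖ₑ ^ 2 ≤
      2 * sobolevSum k φ := by
    rw [← ofReal_multForm_self (hm _) (hm0 _)]
    have h1 : multForm (m (s n)) ψ ψ = ∑ A ∈ P, energyForm (s n) A ψ :=
      multForm_sum_weight _ (hbE _) ψ ψ
    rw [h1]
    refine (ENNReal.ofReal_le_ofReal (hle _ (hs0 n))).trans ?_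
    rw [ENNReal.ofReal_mul zero_le_two, ENNReal.ofReal_ofNat]
    refine mul_le_mul_right ?_ 2
    rw [← multForm_sum_weight _ fun A => isBddWeight_discreteWeight (s n) A,
      ofReal_multForm_self (IsBddWeight.sum _ fun A => isBddWeight_discreteWeight (s n) A)
        fun ξ => Finset.sum_nonneg fun A _ => (discreteWeight_pos _ A ξ).le]
    refine lintegral_mono fun ξ => ?_
    refine mul_le_mul_left (ENNReal.ofReal_le_ofReal (Finset.sum_le_sum fun A _ => ?_)) _
    exact Finset.prod_le_prod (fun i _ => zero_le_one.trans (one_le_discreteSymbol _ i ξ))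
      fun i _ => discreteSymbol_le _ i ξ
  have hmeas (f : WaveFn d N) :
      AEMeasurable (fun ξ => ‖𝓕 f ξ‖ₑ ^ 2) (volume : Measure (Config d N)) :=
    (Lp.aestronglyMeasurable (𝓕 f : WaveFn d N)).enorm.pow_const 2
  have hlim (ξ : Config d N) : ENNReal.ofReal (((k + 1) * (k + 2) : ℝ) *
      ∑ J ∈ Finset.univ.powersetCard (k + 2), ∏ i ∈ J, (1 + laplaceSymbol ξ i)) * ‖𝓕 ψ ξ‖ₑ ^ 2 ≤
      Filter.liminf (fun n => ENNReal.ofReal (m (s n) ξ) * ‖𝓕 ψ ξ‖ₑ ^ 2) Filter.atTop := by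
    have h1 : Filter.Tendsto (fun n => m (s n) ξ) Filter.atTop
        (nhds (∑ A ∈ P, (∏ i ∈ A, (1 + laplaceSymbol ξ i)) *
          (∑ j ∈ Aᶜ, (1 + laplaceSymbol ξ j)) ^ 2)) :=
      tendsto_finsetSum _ fun A _ =>
        (tendsto_finsetProd _ fun i _ => (tendsto_discreteSymbol i ξ).comp hs).mul
          ((tendsto_finsetSum _ fun j _ => (tendsto_discreteSymbol j ξ).comp hs).pow 2)
    have h2 := ENNReal.Tendsto.mul_const (b := ‖𝓕 ψ ξ‖ₑ ^ 2) (ENNReal.tendsto_ofReal h1)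
      (Or.inr (by simp))
    rw [h2.liminf_eq]
    exact mul_le_mul_left (ENNReal.ofReal_le_ofReal (esymm_le_sum_mul_sq k _ fun i =>
      add_nonneg zero_le_one (laplaceSymbol_nonneg ξ i))) _
  have hL : (((k + 1) * (k + 2) : ℕ) : ℝ≥0∞) * sobolevSum (k + 2) ψ =
      ∫⁻ ξ, ENNReal.ofReal (((k + 1) * (k + 2) : ℝ) *
        ∑ J ∈ Finset.univ.powersetCard (k + 2), ∏ i ∈ J, (1 + laplaceSymbol ξ i)) *
          ‖𝓕 ψ ξ‖ₑ ^ 2 := by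
    rw [sobolevSum, ← lintegral_const_mul' _ _ (ENNReal.natCast_ne_top _)]
    refine lintegral_congr fun ξ => ?_
    rw [ENNReal.ofReal_mul (by positivity), ← mul_assoc]
    congr 2
    rw [← ENNReal.ofReal_natCast]
    push_cast
    rfl
  rw [hL]
  refine (lintegral_mono hlim).trans ((lintegral_liminf_le' fun n =>
    ((hm _).1.ennreal_ofReal.aemeasurable.mul (hmeas ψ))).trans ?_)
  exact Filter.liminf_le_of_le (by isBoundedDefault) fun b hb => by
    obtain ⟨n, hn⟩ := hb.exists
    exact hn.trans (hbound n)

end Limit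

/-! ### Powers of the Hamiltonian -/

section Induction

variable {d N : ℕ}

/-- `ShiftedPowRel` is defined by peeling off the last application of `H + N`; this peels off the
first one. -/
lemma ShiftedPowRel.exists_first {U : Config d N → ℝ} : ∀ {m : ℕ} {ψ φ : WaveFn d N},
    ShiftedPowRel U (m + 1) ψ φ → ∃ η : WaveFn d N,
      HamiltonianRel U ψ η ∧ ShiftedPowRel U m (η + (N : ℂ) • ψ) φ
  | 0, ψ, φ, ⟨χ, η, h1, h2, h3⟩ => by
    obtain rfl : χ = ψ := h1
    exact ⟨η, h2, h3⟩
  | m + 1, ψ, φ, ⟨χ, η, h1, h2, h3⟩ => by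
    obtain ⟨η', h4, h5⟩ := h1.exists_first
    exact ⟨η', h4, χ, η, h5, h2, h3⟩

lemma le_powForm_add_two {U : Config d N → ℝ} {k : ℕ} {ψ : WaveFn d N} {b : ℝ≥0∞}
    (hb : ∀ η, HamiltonianRel U ψ η → b ≤ powForm U k (η + (N : ℂ) • ψ)) :
    b ≤ powForm U (k + 2) ψ := by
  unfold powForm
  refine le_iInf₂ fun φ hφ => ?_
  have h1 : (k + 2) / 2 = k / 2 + 1 := by omega
  rw [h1] at hφ
  obtain ⟨η, h2, h3⟩ := hφ.exists_first
  have h4 := (hb η h2).trans (iInf₂_le φ h3)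
  have h5 : Even (k + 2) ↔ Even k := by simp [Nat.even_add]
  simpa only [h5] using h4

lemma HamiltonianRel.fourier_shifted {U : Config d N → ℝ} {ψ η : WaveFn d N}
    (hη : HamiltonianRel U ψ η) : ∃ w : WaveFn d N, (∀ᵐ x, w x = (U x : ℂ) * ψ x) ∧
      ∀ᵐ ξ : Config d N, 𝓕 (η + (N : ℂ) • ψ) ξ =
        ((∑ i, (1 + laplaceSymbol ξ i) : ℝ) : ℂ) * 𝓕 ψ ξ + 𝓕 w ξ := by
  obtain ⟨w, hw, h1⟩ := hη
  refine ⟨w, hw, ?_⟩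
  rw [FourierAdd.fourier_add, FourierSMul.fourier_smul]
  filter_upwards [h1, Lp.coeFn_add (𝓕 η : WaveFn d N) ((N : ℂ) • 𝓕 ψ : WaveFn d N),
    Lp.coeFn_smul (N : ℂ) (𝓕 ψ : WaveFn d N)] with ξ h2 h3 h4
  rw [h3, Pi.add_apply, h4, h2, Pi.smul_apply, Finset.sum_add_distrib, smul_eq_mul]
  simp
  ring

lemma lintegral_enorm_fourier_sq (f : WaveFn d N) : ∫⁻ ξ, ‖𝓕 f ξ‖ₑ ^ 2 = ‖f‖ₑ ^ 2 := by
  have h1 : ‖f‖ₑ = ‖(𝓕 f : WaveFn d N)‖ₑ := by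
    rw [← ofReal_norm, ← ofReal_norm, Lp.norm_fourier_eq]
  rw [h1, Lp.enorm_def, eLpNorm_eq_lintegral_rpow_enorm_toReal two_ne_zero ENNReal.ofNat_ne_top,
    ← ENNReal.rpow_natCast, ← ENNReal.rpow_mul]
  simp

lemma sobolevSum_zero (f : WaveFn d N) : sobolevSum 0 f = ‖f‖ₑ ^ 2 := by
  simp [sobolevSum, lintegral_enorm_fourier_sq]

/-- For `k = 1` the estimate only discards the non-negative potential energy. -/
lemma sobolevSum_one_le (U : Config d N → ℝ) (f : WaveFn d N) :
    sobolevSum 1 f ≤ shiftedForm U f := by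
  have h1 (ξ : Config d N) : ENNReal.ofReal (∑ A ∈ (Finset.univ : Finset (Fin N)).powersetCard 1,
      ∏ i ∈ A, (1 + laplaceSymbol ξ i)) * ‖𝓕 f ξ‖ₑ ^ 2 =
      ENNReal.ofReal (∑ i, laplaceSymbol ξ i) * ‖𝓕 f ξ‖ₑ ^ 2 + N * ‖𝓕 f ξ‖ₑ ^ 2 := by
    rw [Finset.powersetCard_one, Finset.sum_map]
    simp only [Function.Embedding.coeFn_mk, Finset.prod_singleton]
    rw [Finset.sum_add_distrib, Finset.sum_const, Finset.card_univ, Fintype.card_fin, nsmul_one,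
      ENNReal.ofReal_add (by positivity) (Finset.sum_nonneg fun i _ => laplaceSymbol_nonneg ξ i),
      ENNReal.ofReal_natCast, add_mul, add_comm]
  have h2 : sobolevSum 1 f =
      (∫⁻ ξ, ENNReal.ofReal (∑ i, laplaceSymbol ξ i) * ‖𝓕 f ξ‖ₑ ^ 2) + N * ‖f‖ₑ ^ 2 := by
    rw [sobolevSum, lintegral_congr h1, lintegral_add_right', lintegral_const_mul' _ _ (by simp),
      lintegral_enorm_fourier_sq]
    exact ((Lp.aestronglyMeasurable (𝓕 f : WaveFn d N)).enorm.pow_const 2).const_mul _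
  rw [h2, shiftedForm]
  gcongr
  exact le_self_add

/-- The interaction bound is of order `N^{p₀dβ}`, and the gain `N^{-1/2}` beats it. -/
lemma tendsto_interactionBound {p₀ : ℕ} {β : ℝ} (hβ0 : 0 < β)
    (hβ : (p₀ : ℝ) * d * β < 1 / 2) (k : ℕ) (M : ℕ → ℝ) :
    Filter.Tendsto (fun N : ℕ => interactionBound d N p₀ k β M * (k + 1) * (5 / 2) * (√N)⁻¹)
      Filter.atTop (nhds 0) := by
  have h1 (N : ℕ) : interactionBound d N p₀ k β M * (k + 1) * (5 / 2) * (√N)⁻¹ =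
      ∑ p ∈ Finset.Icc 1 p₀, ((2 * d + 2 : ℝ) ^ k * M p * (p + 1) * (k + 2) ^ p * (k + 1) *
        (5 / 2)) * ((N : ℝ) ^ ((p : ℝ) * (d : ℝ) * β) * (√N)⁻¹) := by
    rw [interactionBound, Finset.sum_mul, Finset.sum_mul, Finset.sum_mul]
    exact Finset.sum_congr rfl fun p _ => by ring
  simp only [h1]
  have h0 : (0 : ℝ) = ∑ _p ∈ Finset.Icc 1 p₀, (0 : ℝ) := by simp
  rw [h0]
  refine tendsto_finsetSum _ fun p hp => ?_
  rw [← mul_zero ((2 * d + 2 : ℝ) ^ k * M p * (p + 1) * (k + 2) ^ p * (k + 1) * (5 / 2))]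
  refine Filter.Tendsto.const_mul _ ?_
  have hp' : (p : ℝ) ≤ p₀ := by exact_mod_cast (Finset.mem_Icc.1 hp).2
  have h2 : (p : ℝ) * d * β ≤ p₀ * d * β := by gcongr
  have h3 := (tendsto_rpow_neg_atTop (y := 1 / 2 - (p : ℝ) * d * β) (by linarith)).comp
    tendsto_natCast_atTop_atTop
  refine h3.congr' ?_
  filter_upwards [Filter.eventually_gt_atTop 0] with N hN
  have hN0 : (0 : ℝ) < N := by exact_mod_cast hN
  rw [Function.comp_apply, Real.sqrt_eq_rpow, ← Real.rpow_neg hN0.le, ← Real.rpow_add hN0]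
  congr 1
  ring

/-- The energy estimate without any symmetry assumption: all sets of `k` particles are treated at
once. -/
lemma factorial_mul_sobolevSum_le {p₀ : ℕ} {V : (p : ℕ) → Config d p → ℝ}
    (hV : ∀ p ∈ Finset.Icc 1 p₀, MemSobolevInfty p (V p))
    (hVpos : ∀ p ∈ Finset.Icc 1 p₀, ∀ᵐ y, 0 ≤ V p y) {β : ℝ} (hβ0 : 0 < β) (hβ1 : β ≤ 1)
    (hβ : (p₀ : ℝ) * d * β < 1 / 2) : ∀ k : ℕ, ∃ N₀ : ℕ, ∀ N : ℕ, N₀ ≤ N → ∀ ψ : WaveFn d N,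
      (k.factorial : ℝ≥0∞) * sobolevSum k ψ ≤ 2 ^ k * powForm (interaction d N p₀ β V) k ψ
  | 0 => ⟨0, fun N _ ψ => by
      rw [powForm]
      simp only [Nat.factorial_zero, Nat.cast_one, one_mul, pow_zero, sobolevSum_zero]
      refine le_iInf₂ fun φ hφ => ?_
      obtain rfl : φ = ψ := hφ
      simp⟩
  | 1 => ⟨0, fun N _ ψ => by
      simp only [Nat.factorial_one, Nat.cast_one, one_mul, pow_one]
      have h1 : sobolevSum 1 ψ ≤ powForm (interaction d N p₀ β V) 1 ψ := by
        rw [powForm]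
        refine le_iInf₂ fun φ hφ => ?_
        obtain rfl : φ = ψ := hφ
        simpa using sobolevSum_one_le _ φ
      refine h1.trans ?_
      rw [two_mul]
      exact le_self_add⟩
  | k + 2 => by
    obtain ⟨N₁, hN₁⟩ := factorial_mul_sobolevSum_le hV hVpos hβ0 hβ1 hβ k
    have hM' (p : ℕ) : ∃ M : ℝ, p ∈ Finset.Icc 1 p₀ → 0 < M ∧ RelativeDiffBound (V p) M := by
      by_cases hp : p ∈ Finset.Icc 1 p₀
      · obtain ⟨M, hM⟩ := (hV p hp).exists_relativeDiffBound
        exact ⟨M, fun _ => hM⟩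
      · exact ⟨0, fun h => absurd h hp⟩
    choose M hM using hM'
    obtain ⟨N₂, hN₂⟩ := Filter.eventually_atTop.1
      ((tendsto_interactionBound hβ0 hβ k M).eventually_le_const (by norm_num : (0 : ℝ) < 1 / 4))
    refine ⟨max (max N₁ N₂) (2 * k + 1), fun N hN ψ => ?_⟩
    have h1 : N₁ ≤ N := (le_max_left _ _).trans ((le_max_left _ _).trans hN)
    have h2 : N₂ ≤ N := (le_max_right _ _).trans ((le_max_left _ _).trans hN)
    have h3 : 2 * k + 1 ≤ N := (le_max_right _ _).trans hN
    have h4 : ((k + 2).factorial : ℝ≥0∞) * sobolevSum (k + 2) ψ / 2 ^ (k + 2) ≤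
        powForm (interaction d N p₀ β V) (k + 2) ψ := by
      refine le_powForm_add_two fun η hη => ENNReal.div_le_of_le_mul' ?_
      obtain ⟨w, hw, hF⟩ := hη.fourier_shifted
      have h5 := mul_sobolevSum_le_of_discrete fun h hh =>
        sum_energyForm_le (fun p hp => (hV p hp).1.1) hVpos (fun p hp => (hM p hp).2)
          (fun p hp => (hM p hp).1) (by omega) hβ0 hβ1 hh (by omega) (hN₂ N h2) hF hw
      have h6 := hN₁ N h1 (η + (N : ℂ) • ψ)
      have h7 : (((k + 2).factorial : ℕ) : ℝ≥0∞) =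
          (k.factorial : ℝ≥0∞) * (((k + 1) * (k + 2) : ℕ) : ℝ≥0∞) := by
        rw [Nat.factorial_succ, Nat.factorial_succ]
        push_cast
        ring
      calc ((k + 2).factorial : ℝ≥0∞) * sobolevSum (k + 2) ψ
          = (k.factorial : ℝ≥0∞) * ((((k + 1) * (k + 2) : ℕ) : ℝ≥0∞) * sobolevSum (k + 2) ψ) := by
            rw [h7, mul_assoc]
        _ ≤ (k.factorial : ℝ≥0∞) * (2 * sobolevSum k (η + (N : ℂ) • ψ)) := by gcongr
        _ = 2 * ((k.factorial : ℝ≥0∞) * sobolevSum k (η + (N : ℂ) • ψ)) := by ring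
        _ ≤ 2 * (2 ^ k * powForm (interaction d N p₀ β V) k (η + (N : ℂ) • ψ)) := by gcongr
        _ = 2 ^ (k + 1) * powForm (interaction d N p₀ β V) k (η + (N : ℂ) • ψ) := by ring
        _ ≤ _ := by
          gcongr
          · norm_num
          · norm_num
    rwa [ENNReal.div_le_iff_le_mul (by simp) (by simp),
      mul_comm (powForm _ _ _)] at h4

end Induction

/-! ### Symmetric wave functions -/

section Symmetric

variable {d N : ℕ}

/-- Permuting the particles, as a linear isometry of the configuration space. -/
def permuteIsometry (σ : Equiv.Perm (Fin N)) : Config d N ≃ₗᵢ[ℝ] Config d N :=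
  LinearIsometryEquiv.piLpCongrLeft 2 ℝ ℝ (σ.symm.prodCongr (Equiv.refl (Fin d)))

lemma permuteIsometry_apply (σ : Equiv.Perm (Fin N)) (x : Config d N) :
    permuteIsometry σ x = permute σ x := by
  ext ⟨i, a⟩
  simp [permuteIsometry, permute, LinearIsometryEquiv.piLpCongrLeft_apply]

lemma IsSymmetric.fourier {ψ : WaveFn d N} (hψ : IsSymmetric ψ) (σ : Equiv.Perm (Fin N)) :
    ∀ᵐ ξ : Config d N, 𝓕 ψ (permuteIsometry σ ξ) = 𝓕 ψ ξ := by
  have h1 : Lp.compMeasurePreserving (permuteIsometry σ) (permuteIsometry σ).measurePreserving ψ =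
      ψ := by
    refine Lp.ext ?_
    filter_upwards [hψ σ, Lp.coeFn_compMeasurePreserving ψ (permuteIsometry σ).measurePreserving]
      with x h2 h3
    rw [h3, Function.comp_apply, permuteIsometry_apply, h2]
  have h2 := fourier_comp_isometry (permuteIsometry (d := d) σ) ψ
  rw [h1] at h2
  have h3 := Lp.coeFn_compMeasurePreserving (𝓕 ψ : WaveFn d N)
    (permuteIsometry (d := d) σ).measurePreserving
  rw [← h2] at h3
  filter_upwards [h3] with ξ h4
  exact h4.symm

lemma laplaceSymbol_permuteIsometry (σ : Equiv.Perm (Fin N)) (ξ : Config d N) (i : Fin N) :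
    laplaceSymbol (permuteIsometry σ ξ) i = laplaceSymbol ξ (σ i) := by
  rw [permuteIsometry_apply]
  rfl

lemma IsSymmetric.lintegral_prod_eq {ψ : WaveFn d N} (hψ : IsSymmetric ψ) {A B : Finset (Fin N)}
    (hAB : A.card = B.card) :
    ∫⁻ ξ, ENNReal.ofReal (∏ i ∈ A, (1 + laplaceSymbol ξ i)) * ‖𝓕 ψ ξ‖ₑ ^ 2 =
      ∫⁻ ξ, ENNReal.ofReal (∏ i ∈ B, (1 + laplaceSymbol ξ i)) * ‖𝓕 ψ ξ‖ₑ ^ 2 := by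
  obtain ⟨σ, hσ⟩ : ∃ σ : Equiv.Perm (Fin N), A.map σ.toEmbedding = B := by
    let e : {i // i ∈ A} ≃ {i // i ∈ B} := A.equivOfCardEq hAB
    refine ⟨e.extendSubtype, Finset.eq_of_subset_of_card_le (fun i hi => ?_) (by simp [hAB])⟩
    obtain ⟨j, hj, rfl⟩ := Finset.mem_map.1 hi
    exact e.extendSubtype_mem j hj
  rw [← (permuteIsometry (d := d) σ).measurePreserving.lintegral_comp_emb
    (permuteIsometry (d := d) σ).toHomeomorph.measurableEmbedding]
  refine lintegral_congr_ae ?_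
  filter_upwards [hψ.fourier σ] with ξ h1
  rw [h1, ← hσ, Finset.prod_map]
  simp only [laplaceSymbol_permuteIsometry]
  rfl

lemma IsSymmetric.sobolevSum_eq {ψ : WaveFn d N} (hψ : IsSymmetric ψ) {k : ℕ} (hk : k ≤ N) :
    sobolevSum k ψ = (N.choose k : ℝ≥0∞) * sobolevForm k ψ := by
  have hcard : (Finset.univ.filter fun i : Fin N => i.val < k).card = k := by
    rw [Fin.card_filter_val_lt, min_eq_right hk]
  have h1 : ∀ A ∈ (Finset.univ : Finset (Fin N)).powersetCard k,
      ∫⁻ ξ, ENNReal.ofReal (∏ i ∈ A, (1 + laplaceSymbol ξ i)) * ‖𝓕 ψ ξ‖ₑ ^ 2 = sobolevForm k ψ :=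
    fun A hA => hψ.lintegral_prod_eq ((Finset.mem_powersetCard.1 hA).2.trans hcard.symm)
  have h2 (ξ : Config d N) : ENNReal.ofReal (∑ A ∈ (Finset.univ : Finset (Fin N)).powersetCard k,
      ∏ i ∈ A, (1 + laplaceSymbol ξ i)) * ‖𝓕 ψ ξ‖ₑ ^ 2 =
      ∑ A ∈ (Finset.univ : Finset (Fin N)).powersetCard k,
        ENNReal.ofReal (∏ i ∈ A, (1 + laplaceSymbol ξ i)) * ‖𝓕 ψ ξ‖ₑ ^ 2 := by
    rw [ENNReal.ofReal_sum_of_nonneg fun A _ => Finset.prod_nonneg fun i _ =>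
      add_nonneg zero_le_one (laplaceSymbol_nonneg ξ i), Finset.sum_mul]
  rw [sobolevSum, lintegral_congr h2, lintegral_finsetSum', Finset.sum_congr rfl h1,
    Finset.sum_const, Finset.card_powersetCard, Finset.card_univ, Fintype.card_fin, nsmul_eq_mul]
  intro A _
  have h3 : Measurable fun ξ : Config d N => ∏ i ∈ A, (1 + laplaceSymbol ξ i) :=
    Finset.measurable_prod _ fun i _ => (measurable_laplaceSymbol i).const_add 1
  exact h3.ennreal_ofReal.aemeasurable.mul
    ((Lp.aestronglyMeasurable (𝓕 ψ : WaveFn d N)).enorm.pow_const 2)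

lemma pow_le_two_pow_mul_factorial_mul_choose {k : ℕ} (hk : 2 * k ≤ N) :
    N ^ k ≤ 2 ^ k * (k.factorial * N.choose k) := by
  rw [← Nat.descFactorial_eq_factorial_mul_choose]
  calc N ^ k ≤ (2 * (N + 1 - k)) ^ k := Nat.pow_le_pow_left (by omega) k
    _ = 2 ^ k * (N + 1 - k) ^ k := mul_pow _ _ _
    _ ≤ _ := Nat.mul_le_mul_left _ (Nat.pow_sub_le_descFactorial N k)

end Symmetric

end

end ManyBody

open ManyBody in
theorem proposition2p1 (d : ℕ) (hd : d = 1 ∨ d = 2) (p₀ : ℕ) (hp₀ : 1 ≤ p₀)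
    (V : (p : ℕ) → Config d p → ℝ)
    (hV : ∀ p ∈ Finset.Icc 1 p₀, MemSobolevInfty p (V p))
    (hVnonneg : ∀ p ∈ Finset.Icc 1 p₀, ∀ᵐ y : Config d p, 0 ≤ V p y) :
    ∃ C : ℝ, 0 < C ∧
      ∀ β : ℝ, 0 < β → β < 1 / (2 * (d : ℝ) * (p₀ : ℝ) + 2) →
        ∀ k : ℕ, ∃ N₀ : ℕ, k ≤ N₀ ∧ ∀ N : ℕ, N₀ ≤ N →
          ∀ ψ : WaveFn d N, IsSymmetric ψ →
            ENNReal.ofReal (C ^ k * (N : ℝ) ^ k) * sobolevForm k ψ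
              ≤ powForm (interaction d N p₀ β V) k ψ := by
  refine ⟨1 / 4, by norm_num, fun β hβ0 hβ k => ?_⟩
  have hdp : (0 : ℝ) ≤ 2 * d * p₀ := by positivity
  rw [lt_div_iff₀ (by positivity)] at hβ
  have hβ1 : β ≤ 1 := by nlinarith
  have hβ2 : (p₀ : ℝ) * d * β < 1 / 2 := by linarith
  obtain ⟨N₁, hN₁⟩ := factorial_mul_sobolevSum_le hV hVnonneg hβ0 hβ1 hβ2 k
  refine ⟨max N₁ (2 * k), by omega, fun N hN ψ hψ => ?_⟩
  have h1 := hN₁ N ((le_max_left _ _).trans hN) ψ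
  have hk : 2 * k ≤ N := (le_max_right _ _).trans hN
  rw [hψ.sobolevSum_eq (by omega)] at h1
  have h2 : ((N ^ k : ℕ) : ℝ≥0∞) ≤ ((2 ^ k * (k.factorial * N.choose k) : ℕ) : ℝ≥0∞) :=
    Nat.cast_le.2 (pow_le_two_pow_mul_factorial_mul_choose hk)
  have h3 : ENNReal.ofReal ((1 / 4) ^ k * (N : ℝ) ^ k) = ((N ^ k : ℕ) : ℝ≥0∞) / 4 ^ k := by
    rw [one_div, inv_pow, ← div_eq_inv_mul, ENNReal.ofReal_div_of_pos (by positivity),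
      ENNReal.ofReal_pow (by positivity), ENNReal.ofReal_pow (by positivity),
      ENNReal.ofReal_natCast, ENNReal.ofReal_ofNat, Nat.cast_pow]
  rw [h3, ENNReal.mul_comm_div, ← mul_div_assoc, ENNReal.div_le_iff_le_mul (by simp) (by simp)]
  calc ((N ^ k : ℕ) : ℝ≥0∞) * sobolevForm k ψ
      ≤ ((2 ^ k * (k.factorial * N.choose k) : ℕ) : ℝ≥0∞) * sobolevForm k ψ := by gcongr
    _ = 2 ^ k * (k.factorial * (N.choose k * sobolevForm k ψ)) := by push_cast; ring
    _ ≤ 2 ^ k * (2 ^ k * powForm (interaction d N p₀ β V) k ψ) := by gcongr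
    _ = powForm (interaction d N p₀ β V) k ψ * 4 ^ k := by
      rw [← mul_assoc, ← mul_pow, mul_comm]
      norm_num
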